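/- Consider a downlink network in the plane $\mathbb R^2$ with $K$ open-access tiers, indexed by $1,\dots,K$, and $L\ge 0$ closed-access tiers, indexed by $c_1,\dots,c_L$ (so $L=1$ is a single closed-access tier and $L=0$ means that there is none). The base stations of tier $t$ form a homogeneous Poisson point process of intensity $\lambda_t>0$, with points $X_{t,1},X_{t,2},\dots$; they have transmission power $P_t>0$, path-loss exponent $\varepsilon_t>2$, and i.i.d. fading gains $\Psi_{t,n}\ge 0$ distributed as $\Psi_t$, with $\mathbb E[\Psi_t^{2/\varepsilon_t}]<\infty$; for open-access tiers $\Psi_t$ is not almost surely $0$. The point processes of the different tiers and all the fading gains are independent. The mobile station is at the origin and receives the power $Q_{t,n}=P_t\Psi_{t,n}|X_{t,n}|^{-\varepsilon_t}$ from the $n$-th base station of tier $t$. With noise power $\eta\ge 0$, the SINR of the $i$-th base station of the open-access tier $k$ is $$\mathrm{SINR}_{k,i}=\frac{Q_{k,i}}{\sum_{(t,n)\ne(k,i)}Q_{t,n}+\eta},$$ the sum being over all other base stations of all open- and closed-access tiers. For thresholds $\beta_1,\dots,\beta_K$ let $\mathbb P^{\text{max-SINR}}_{\rm coverage}=\mathbb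 P(\exists\, k\le K,\ i\ge 1:\ \mathrm{SINR}_{k,i}>\beta_k)$, and let $\mathbb P^{\text{MIRP}}_{\rm coverage}=\mathbb P(\mathrm{SINR}_{T,I}>\beta_T)$, where $(T,I)$ is the open-access base station with the maximum received power $Q_{k,i}$. Write $a_t=\lambda_tP_t^{2/\varepsilon_t}\,\mathbb E[\Psi_t^{2/\varepsilon_t}]$ and $\operatorname{sinc}x=\frac{\sin x}{x}$. If $\beta_k\ge 1$ for all $k=1,\dots,K$, then $$\mathbb P^{\text{max-SINR}}_{\rm coverage}=\mathbb P^{\text{MIRP}}_{\rm coverage}=\sum_{k=1}^K\frac{a_k\,\beta_k^{-2/\varepsilon_k}}{\Gamma(1+\frac2{\varepsilon_k})}\int_0^\infty 2\pi r\,\exp\Big(-\eta r^{\varepsilon_k}-\sum_{t}\frac{\pi\,a_t\,r^{2\varepsilon_k/\varepsilon_t}}{\Gamma(1+\frac2{\varepsilon_t})\operatorname{sinc}(\frac{2\pi}{\varepsilon_t})}\Big)\,dr,$$ where $t$ runs over all tiers, of open and of closed access, and the integrals converge. If moreover $\eta=0$ and all tiers, of open and of closed access, have the same path-loss exponent $\varepsilon$,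 then $$\mathbb P^{\text{max-SINR}}_{\rm coverage}=\mathbb P^{\text{MIRP}}_{\rm coverage}=\frac{\sum_{k=1}^K a_k\,\operatorname{sinc}(\frac{2\pi}{\varepsilon})\,\beta_k^{-2/\varepsilon}}{\sum_{l=1}^L a_{c_l}+\sum_{l=1}^K a_l}.$$ -/

import Mathlib

open MeasureTheory ProbabilityTheory
open scoped ENNReal NNReal

noncomputable section

namespace HetNet

/-- The plane in which the base stations are placed; the mobile station sits at the origin. -/
abbrev Plane : Type := EuclideanSpace ℝ (Fin 2)

/-- The parameters of one tier of base stations: the density of the base stations, their constant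
transmission power, the path-loss exponent and the law of the fading gains. -/
structure Tier where
  density : ℝ≥0
  power : ℝ
  exponent : ℝ
  fading : Measure ℝ
  density_pos : 0 < density
  power_pos : 0 < power
  two_lt_exponent : 2 < exponent
  isProbabilityMeasure_fading : IsProbabilityMeasure fading
  fading_nonneg : ∀ᵐ x ∂fading, 0 ≤ x
  integrable_fading : Integrable (fun x : ℝ => x ^ (2 / exponent)) fading

/-- The fractional moment `E[Ψ ^ (2 / ε)]` of the fading gain. -/
def Tier.moment (t : Tier) : ℝ := ∫ x, x ^ (2 / t.exponent) ∂t.fading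

/-- The effective density `λ P ^ (2 / ε) E[Ψ ^ (2 / ε)]` of a tier. -/
def Tier.effDensity (t : Tier) : ℝ := t.density * t.power ^ (2 / t.exponent) * t.moment

/-- The random counting measure carried by the random points `X 0, X 1, X 2, …`. -/
def pointMeasure {Ω : Type*} (X : ℕ → Ω → Plane) (ω : Ω) : Measure Plane :=
  Measure.sum fun n => Measure.dirac (X n ω)

/-- `X 0, X 1, X 2, …` enumerates the points of a homogeneous Poisson point process of intensity
`lam` in the plane: the number of points in a Borel set `B` of finite area is Poisson distributed
with mean `lam * area B`, and the numbers of points in disjoint Borel sets are independent. -/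
structure IsPoissonProcess {Ω : Type*} [MeasurableSpace Ω] (μ : Measure Ω) (lam : ℝ≥0)
    (X : ℕ → Ω → Plane) : Prop where
  measurable : ∀ n, Measurable (X n)
  hasLaw_count : ∀ B : Set Plane, MeasurableSet B → volume B ≠ ∞ →
    HasLaw (fun ω => pointMeasure X ω B)
      ((poissonMeasure (lam * (volume B).toNNReal)).map (fun n : ℕ => (n : ℝ≥0∞))) μ
  indep_count : ∀ (m : ℕ) (B : Fin m → Set Plane), (∀ i, MeasurableSet (B i)) →
    Pairwise (fun i j => Disjoint (B i) (B j)) →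
    iIndepFun (fun i ω => pointMeasure X ω (B i)) μ

/-- A heterogeneous network with open-access tiers `o` and closed-access tiers `c`, realised on the
probability space `(Ω, μ)`: `pos t n` is the position and `gain t n` the fading gain of the `n`-th
base station of the tier `t`. -/
structure Network {Ω : Type*} [MeasurableSpace Ω] (μ : Measure Ω) {K L : ℕ}
    (o : Fin K → Tier) (c : Fin L → Tier) where
  pos : Fin K ⊕ Fin L → ℕ → Ω → Plane
  gain : Fin K ⊕ Fin L → ℕ → Ω → ℝ
  isPoissonProcess : ∀ t, IsPoissonProcess μ (Sum.elim o c t).density (pos t)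
  measurable_gain : ∀ t n, Measurable (gain t n)
  hasLaw_gain : ∀ t n, HasLaw (gain t n) (Sum.elim o c t).fading μ
  /-- the point processes of the different tiers are independent -/
  indep_pos : iIndepFun (fun t ω n => pos t n ω) μ
  /-- all the fading gains are independent -/
  indep_gain : iIndepFun (fun (p : (Fin K ⊕ Fin L) × ℕ) ω => gain p.1 p.2 ω) μ
  /-- the fading gains are independent of the positions -/
  indep_pos_gain : IndepFun (fun ω t n => pos t n ω) (fun ω t n => gain t n ω) μ

namespace Network

variable {Ω : Type*} [MeasurableSpace Ω] {μ : Measure Ω} {K L : ℕ}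
  {o : Fin K → Tier} {c : Fin L → Tier}

/-- The power `P Ψ R ^ (-ε)` that the mobile station at the origin receives from the `n`-th base
station of the tier `t`. -/
def rxPower (N : Network μ o c) (t : Fin K ⊕ Fin L) (n : ℕ) (ω : Ω) : ℝ≥0∞ :=
  ENNReal.ofReal ((Sum.elim o c t).power * N.gain t n ω *
    ‖N.pos t n ω‖ ^ (-(Sum.elim o c t).exponent))

/-- The sum of the powers received from all base stations, of open and of closed access, other than
the `i`-th one of the `k`-th open-access tier. -/
def interference (N : Network μ o c) (k : Fin K) (i : ℕ) (ω : Ω) : ℝ≥0∞ :=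
  ∑' p : (Fin K ⊕ Fin L) × ℕ, if p = (Sum.inl k, i) then 0 else N.rxPower p.1 p.2 ω

/-- The SINR of the `i`-th base station of the `k`-th open-access tier, with noise power `η`. -/
def sinr (N : Network μ o c) (η : ℝ) (k : Fin K) (i : ℕ) (ω : Ω) : ℝ≥0∞ :=
  N.rxPower (Sum.inl k) i ω / (N.interference k i ω + ENNReal.ofReal η)

/-- The probability that some open-access base station has an SINR above the threshold of its
tier. -/
def coverageMaxSINR (N : Network μ o c) (η : ℝ) (β : Fin K → ℝ) : ℝ :=
  μ.real {ω | ∃ k i, ENNReal.ofReal (β k) < N.sinr η k i ω}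

/-- `(k, i)` is an open-access base station from which the received power is maximal. -/
def IsServing (N : Network μ o c) (k : Fin K) (i : ℕ) (ω : Ω) : Prop :=
  ∀ l j, N.rxPower (Sum.inl l) j ω ≤ N.rxPower (Sum.inl k) i ω

/-- The probability that the open-access base station with the maximum instantaneous received power
has an SINR above the threshold of its tier. -/
def coverageMIRP (N : Network μ o c) (η : ℝ) (β : Fin K → ℝ) : ℝ :=
  μ.real {ω | ∃ k i, N.IsServing k i ω ∧ ENNReal.ofReal (β k) < N.sinr η k i ω}

end Network

/-- The term
`∑ λ π P ^ (2 / ε) E[Ψ ^ (2 / ε)] r ^ (2 e / ε) / (Γ (1 + 2 / ε) sinc (2 π / ε))`,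
summed over the tiers `t`. -/
def interferenceExponent {m : ℕ} (t : Fin m → Tier) (e r : ℝ) : ℝ :=
  ∑ l, Real.pi * (t l).effDensity * r ^ (2 * e / (t l).exponent) /
    (Real.Gamma (1 + 2 / (t l).exponent) * Real.sinc (2 * Real.pi / (t l).exponent))

/-- The integrand of the radial integral for an open-access tier with path-loss exponent `e`. -/
def radialIntegrand {K L : ℕ} (o : Fin K → Tier) (c : Fin L → Tier) (η e r : ℝ) : ℝ :=
  2 * Real.pi * r *
    Real.exp (-η * r ^ e - interferenceExponent c e r - interferenceExponent o e r)

end HetNet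

end

/-! Since every threshold is at least `1`, a covering base station is received with more power than
all the others together. Hence at most one base station covers, it is the one of maximum received
power, and the two coverage events coincide (`interference_lt_rxPower`). The coverage probability
therefore equals the expected number of covering base stations.

This expectation is computed by Mecke's formula (`HasPoissonLaplace.lintegral_tsum_rest`). The
marked points (tier, position, gain) form a Poisson process, so the power from the other points may
be replaced by the total power `I`, while the point is integrated against the intensity measure. The
mean number of points of tier `k` received above a level `a` is `π a_k a ^ (-2/ε_k)`
(`Tier.lintegral_lt_rxPower`). With `a = β_k (I + η)`, coverage has probability `∑ π a_k β_k ^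
(-2/ε_k) E[(I + η) ^ (-2/ε_k)]`. Writing the negative power as a mixture of exponentials `exp (-r ^
ε_k (I + η))` turns the moment into the radial integral of the Laplace transform of `I`
(`lintegral_totalPower_rpow`). That transform comes from the Laplace functional, with tier exponents
`π a_t s ^ (2/ε_t) Γ(1 - 2/ε_t)`; Euler's reflection formula brings in the sinc.

The Poisson process is known only through its counts. Its Laplace functional is obtained from simple
functions by monotone limits, and independent marks and tiers are then added. Mecke's formula
follows by differentiating the functional in a perturbation and using that Laplace transforms at the
natural numbers determine finite measures on `[0, ∞]`. -/

noncomputable section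

namespace HetNet

/-! ### The exponential `exp (-y)` on `[0, ∞]` and Laplace transforms -/

/-- The function `y ↦ exp (-y)` on `[0, ∞]`, with `exp (-∞) = 0`. -/
def expNeg (y : ℝ≥0∞) : ℝ≥0∞ := EReal.exp (-(y : EReal))

@[simp] lemma expNeg_zero : expNeg 0 = 1 := by simp [expNeg]

@[simp] lemma expNeg_top : expNeg ∞ = 0 := by simp [expNeg]

lemma continuous_expNeg : Continuous expNeg :=
  ENNReal.continuous_exp.comp (continuous_neg.comp continuous_coe_ennreal_ereal)

@[fun_prop]
lemma measurable_expNeg : Measurable expNeg := continuous_expNeg.measurable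

lemma expNeg_strictAnti : StrictAnti expNeg := fun x y h => by
  simpa [expNeg] using h

lemma expNeg_antitone : Antitone expNeg := expNeg_strictAnti.antitone

lemma expNeg_le_one (y : ℝ≥0∞) : expNeg y ≤ 1 := by
  simpa using expNeg_antitone (zero_le (a := y))

lemma expNeg_ne_top (y : ℝ≥0∞) : expNeg y ≠ ∞ := ne_top_of_le_ne_top (by simp) (expNeg_le_one y)

lemma expNeg_add (x y : ℝ≥0∞) : expNeg (x + y) = expNeg x * expNeg y := by
  rw [expNeg, EReal.coe_ennreal_add, EReal.neg_add (by simp) (by simp), sub_eq_add_neg,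
    EReal.exp_add, expNeg, expNeg]

lemma expNeg_sum {ι : Type*} (s : Finset ι) (f : ι → ℝ≥0∞) :
    expNeg (∑ i ∈ s, f i) = ∏ i ∈ s, expNeg (f i) := by
  classical
  induction s using Finset.induction_on with
  | empty => simp
  | insert a s ha ih => rw [Finset.sum_insert ha, Finset.prod_insert ha, expNeg_add, ih]

lemma expNeg_nat_mul (n : ℕ) (y : ℝ≥0∞) : expNeg (n * y) = expNeg y ^ n := by
  simpa using expNeg_sum (Finset.range n) (fun _ => y)

lemma expNeg_ofReal {x : ℝ} (hx : 0 ≤ x) :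
    expNeg (ENNReal.ofReal x) = ENNReal.ofReal (Real.exp (-x)) := by
  rw [expNeg, EReal.coe_ennreal_ofReal, max_eq_left hx, ← EReal.coe_neg, EReal.exp_coe]

lemma expNeg_eq_zero_iff {y : ℝ≥0∞} : expNeg y = 0 ↔ y = ∞ := by
  rw [← expNeg_top, expNeg_strictAnti.injective.eq_iff]

/-- The inverse of `expNeg` on `[0, 1]`. -/
def negLog (v : ℝ≥0∞) : ℝ≥0∞ := (-(ENNReal.log v)).toENNReal

@[fun_prop]
lemma measurable_negLog : Measurable negLog :=
  measurable_ereal_toENNReal.comp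
    (continuous_neg.measurable.comp ENNReal.measurable_log)

lemma expNeg_negLog {v : ℝ≥0∞} (hv : v ≤ 1) : expNeg (negLog v) = v := by
  rw [expNeg, negLog, EReal.coe_toENNReal (by simpa [EReal.neg_nonneg] using hv), neg_neg,
    ENNReal.exp_log]

lemma one_sub_expNeg_le (y : ℝ≥0∞) : 1 - expNeg y ≤ y := by
  induction y with
  | top => simp
  | coe y =>
    rw [← ENNReal.ofReal_coe_nnreal, expNeg_ofReal y.coe_nonneg, ← ENNReal.ofReal_one,
      ← ENNReal.ofReal_sub _ (Real.exp_pos _).le]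
    exact ENNReal.ofReal_le_ofReal (by linarith [Real.add_one_le_exp (-(y : ℝ))])

lemma mul_expNeg_le_one_sub_expNeg (y : ℝ≥0∞) : y * expNeg y ≤ 1 - expNeg y := by
  induction y with
  | top => simp
  | coe y =>
    rw [← ENNReal.ofReal_coe_nnreal, expNeg_ofReal y.coe_nonneg, ← ENNReal.ofReal_one,
      ← ENNReal.ofReal_sub _ (Real.exp_pos _).le, ← ENNReal.ofReal_mul y.coe_nonneg]
    refine ENNReal.ofReal_le_ofReal ?_
    have h1 := Real.add_one_le_exp (y : ℝ)
    have h2 : Real.exp (y : ℝ) * Real.exp (-(y : ℝ)) = 1 := by rw [← Real.exp_add]; simp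
    nlinarith [Real.exp_pos (-(y : ℝ))]

/-- Finite measures on `[0, ∞]` with the same Laplace transforms at the natural numbers are
equal. -/
theorem measure_eq_of_lintegral_expNeg {P Q : Measure ℝ≥0∞} [IsFiniteMeasure P]
    [IsFiniteMeasure Q]
    (h : ∀ n : ℕ, ∫⁻ y, expNeg (n * y) ∂P = ∫⁻ y, expNeg (n * y) ∂Q) : P = Q := by
  have hcont : Continuous fun y => (expNeg y).toReal :=
    ENNReal.continuousOn_toReal.comp_continuous continuous_expNeg expNeg_ne_top
  let f : BoundedContinuousFunction ℝ≥0∞ ℝ := BoundedContinuousFunction.mkOfCompact ⟨_, hcont⟩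
  have hf (y : ℝ≥0∞) : f y = (expNeg y).toReal := rfl
  -- The real polynomials in `exp (-y)`. One injective function already separates the points of the
  -- compact space `[0, ∞]`, so this algebra determines finite measures.
  let A : StarSubalgebra ℝ (BoundedContinuousFunction ℝ≥0∞ ℝ) :=
    { (Polynomial.aeval f : Polynomial ℝ →ₐ[ℝ] _).range with
      star_mem' := fun {a} ha => by
        have : star a = a := by ext; simp
        rwa [this] }
  refine ext_of_forall_mem_subalgebra_integral_eq_of_polish (𝕜 := ℝ) (A := A) ?_ ?_
  · intro x y hxy
    refine ⟨f, ⟨_, ⟨f, ?_, rfl⟩, rfl⟩, ?_⟩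
    · exact ⟨Polynomial.X, by simp⟩
    · intro h
      simp only [hf] at h
      exact hxy (expNeg_strictAnti.injective
        ((ENNReal.toReal_eq_toReal_iff' (expNeg_ne_top _) (expNeg_ne_top _)).1 h))
  · rintro _ ⟨p, rfl⟩
    have key (ρ : Measure ℝ≥0∞) [IsFiniteMeasure ρ] (n : ℕ) :
        ∫ y, (f ^ n) y ∂ρ = (∫⁻ y, expNeg (n * y) ∂ρ).toReal := by
      rw [integral_eq_lintegral_of_nonneg_ae]
      · congr 1
        refine lintegral_congr fun y => ?_
        rw [expNeg_nat_mul, BoundedContinuousFunction.pow_apply, hf,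
          ENNReal.ofReal_pow ENNReal.toReal_nonneg, ENNReal.ofReal_toReal (expNeg_ne_top _)]
      · filter_upwards with y
        simp only [BoundedContinuousFunction.pow_apply, hf, Pi.zero_apply]
        positivity
      · exact (f ^ n).continuous.aestronglyMeasurable
    -- By linearity only the powers `exp (-y) ^ n = exp (-n y)` matter, and these are the
    -- hypothesis.
    induction p using Polynomial.induction_on' with
    | add p q hp hq =>
      simp only [AlgHom.toRingHom_eq_coe, RingHom.coe_coe, map_add] at hp hq ⊢
      simp only [BoundedContinuousFunction.add_apply]
      rw [integral_add (BoundedContinuousFunction.integrable _ _)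
        (BoundedContinuousFunction.integrable _ _), hp, hq,
        integral_add (BoundedContinuousFunction.integrable _ _)
        (BoundedContinuousFunction.integrable _ _)]
    | monomial n a =>
      simp only [AlgHom.toRingHom_eq_coe, RingHom.coe_coe, Polynomial.aeval_monomial]
      have (y : ℝ≥0∞) : (algebraMap ℝ (BoundedContinuousFunction ℝ≥0∞ ℝ) a * f ^ n) y =
          a * (f ^ n) y := by
        simp [BoundedContinuousFunction.mul_apply]
      simp only [this, integral_const_mul, key, h]

/-! ### Difference quotients for differentiating under the expectation -/

/-- The difference quotient `(1 - exp (-t y)) / t` at `t = 2 ^ (-m)`. -/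
def expQuot (m : ℕ) (y : ℝ≥0∞) : ℝ≥0∞ := 2 ^ m * (1 - expNeg ((2 ^ m)⁻¹ * y))

@[fun_prop]
lemma measurable_expQuot (m : ℕ) : Measurable (expQuot m) := by
  unfold expQuot; fun_prop

lemma two_pow_mul_inv (m : ℕ) : (2 ^ m : ℝ≥0∞) * (2 ^ m)⁻¹ = 1 :=
  ENNReal.mul_inv_cancel (by simp) (by simp)

lemma expQuot_mono_right (m : ℕ) : Monotone (expQuot m) := fun x y h => by
  unfold expQuot
  gcongr
  exact expNeg_antitone (by gcongr)

lemma expQuot_le_self (m : ℕ) (y : ℝ≥0∞) : expQuot m y ≤ y :=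
  calc expQuot m y ≤ 2 ^ m * ((2 ^ m)⁻¹ * y) := by
        unfold expQuot; gcongr; exact one_sub_expNeg_le _
    _ = y := by rw [← mul_assoc, two_pow_mul_inv, one_mul]

lemma one_sub_mul_eq {a b : ℝ≥0∞} (ha : a ≤ 1) (hb : b ≤ 1) :
    1 - a * b = (1 - a) + a * (1 - b) := by
  lift a to ℝ≥0 using ne_top_of_le_ne_top (by simp) ha
  lift b to ℝ≥0 using ne_top_of_le_ne_top (by simp) hb
  norm_cast at *
  have h : a * b ≤ 1 := mul_le_one' ha hb
  ext
  push_cast [NNReal.coe_sub h, NNReal.coe_sub ha, NNReal.coe_sub hb]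
  ring

/-- Halving `t` replaces `1 - a ^ 2 = (1 - a) + a (1 - a)` by the larger `2 (1 - a)`, where `a = exp
(-t y / 2)`. Dyadic values of `t` thus give an increasing sequence, and monotone convergence needs
no integrability. -/
lemma monotone_expQuot : Monotone expQuot := by
  refine monotone_nat_of_le_succ fun m y => ?_
  have h : (2 ^ m : ℝ≥0∞)⁻¹ * y = (2 ^ (m + 1))⁻¹ * y + (2 ^ (m + 1))⁻¹ * y := by
    rw [← add_mul, pow_succ, ENNReal.mul_inv (by simp) (by simp), ← mul_add,
      ENNReal.inv_two_add_inv_two, mul_one]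
  unfold expQuot
  rw [h, expNeg_add, one_sub_mul_eq (expNeg_le_one _) (expNeg_le_one _), pow_succ, mul_assoc]
  gcongr
  rw [two_mul]
  gcongr
  exact mul_le_of_le_one_left' (expNeg_le_one _)

-- For finite `y` the quotient lies between `y exp (-t y)` and `y`; for `y = ∞` it is `2 ^ m`.
open Filter Topology in
lemma iSup_expQuot (y : ℝ≥0∞) : ⨆ m, expQuot m y = y := by
  refine le_antisymm (iSup_le fun m => expQuot_le_self m y) ?_
  have h0 : Tendsto (fun m : ℕ => ((2 : ℝ≥0∞) ^ m)⁻¹) atTop (𝓝 0) := by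
    simp [ENNReal.inv_pow]
  induction y with
  | top =>
    have h : Tendsto (fun m : ℕ => (2 : ℝ≥0∞) ^ m) atTop (𝓝 ∞) := by
      simp
    refine le_of_tendsto' h fun m => le_trans ?_ (le_iSup (fun m => expQuot m ∞) m)
    simp [expQuot, ENNReal.mul_top]
  | coe y =>
    have h1 : Tendsto (fun m : ℕ => (y : ℝ≥0∞) * expNeg ((2 ^ m)⁻¹ * y)) atTop (𝓝 y) := by
      have h2 : Tendsto (fun m : ℕ => ((2 : ℝ≥0∞) ^ m)⁻¹ * y) atTop (𝓝 0) := by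
        simpa using ENNReal.Tendsto.mul_const (b := (y : ℝ≥0∞)) h0 (by simp)
      have h3 := (continuous_expNeg.tendsto 0).comp h2
      simpa using ENNReal.Tendsto.const_mul (a := (y : ℝ≥0∞)) h3 (by simp)
    refine le_of_tendsto' h1 fun m => le_trans ?_ (le_iSup (fun m => expQuot m y) m)
    calc (y : ℝ≥0∞) * expNeg ((2 ^ m)⁻¹ * y)
        = 2 ^ m * ((2 ^ m)⁻¹ * y * expNeg ((2 ^ m)⁻¹ * y)) := by
          rw [← mul_assoc, ← mul_assoc, two_pow_mul_inv, one_mul]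
      _ ≤ expQuot m y := by unfold expQuot; gcongr; exact mul_expNeg_le_one_sub_expNeg _

/-- A diagonal argument: in the derivative of the Laplace functional the step size and the integral
inside the exponent vary together. -/
lemma iSup_expQuot_iSup {K : ℕ → ℝ≥0∞} (hK : Monotone K) :
    ⨆ m, expQuot m (K m) = ⨆ m, K m := by
  refine le_antisymm (iSup_mono fun m => expQuot_le_self m _) (iSup_le fun j => ?_)
  rw [← iSup_expQuot (K j)]
  refine iSup_le fun m => ?_
  refine le_trans ?_ (le_iSup (fun m => expQuot m (K m)) (max m j))
  exact (monotone_expQuot (le_max_left m j) _).trans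
    (expQuot_mono_right _ (hK (le_max_right m j)))

/-! ### Mecke's formula from the Laplace functional -/

variable {Ω S ι : Type*}

open Classical in
/-- The sum of `q` over all points other than the `i`-th one. -/
def rest (q : S → ℝ≥0∞) (Y : ι → Ω → S) (i : ι) (ω : Ω) : ℝ≥0∞ :=
  ∑' j, if j = i then 0 else q (Y j ω)

lemma tsum_eq_add_rest (q : S → ℝ≥0∞) (Y : ι → Ω → S) (i : ι) (ω : Ω) :
    ∑' j, q (Y j ω) = q (Y i ω) + rest q Y i ω := by
  classical
  rw [rest, ENNReal.tsum_eq_add_tsum_ite i]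

variable [MeasurableSpace Ω] [MeasurableSpace S]

/-- The random points `Y i` have the Laplace functional of a Poisson process with intensity
measure `Λ`. -/
def HasPoissonLaplace (μ : Measure Ω) (Λ : Measure S) (Y : ι → Ω → S) : Prop :=
  ∀ h : S → ℝ≥0∞, Measurable h →
    ∫⁻ ω, expNeg (∑' i, h (Y i ω)) ∂μ = expNeg (∫⁻ z, (1 - expNeg (h z)) ∂Λ)

namespace HasPoissonLaplace

variable {μ : Measure Ω} {Λ : Measure S} {Y : ι → Ω → S}

/-- Differentiated form of the Laplace functional. -/
theorem lintegral_tsum_mul_expNeg [Countable ι] (hY : HasPoissonLaplace μ Λ Y)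
    (hm : ∀ i, Measurable (Y i)) {g h : S → ℝ≥0∞} (hg : Measurable g) (hh : Measurable h) :
    ∫⁻ ω, (∑' i, g (Y i ω)) * expNeg (∑' i, h (Y i ω)) ∂μ =
      (∫⁻ z, g z * expNeg (h z) ∂Λ) * ∫⁻ ω, expNeg (∑' i, h (Y i ω)) ∂μ := by
  have hG : Measurable fun ω => ∑' i, g (Y i ω) :=
    Measurable.tsum fun i => hg.comp (hm i)
  have hH : Measurable fun ω => ∑' i, h (Y i ω) :=
    Measurable.tsum fun i => hh.comp (hm i)
  have hsum (f : S → ℝ≥0∞) (m : ℕ) (ω : Ω) :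
      (2 ^ m : ℝ≥0∞)⁻¹ * ∑' i, f (Y i ω) = ∑' i, (2 ^ m : ℝ≥0∞)⁻¹ * f (Y i ω) :=
    ENNReal.tsum_mul_left.symm
  set E := ∫⁻ ω, expNeg (∑' i, h (Y i ω)) ∂μ with hE
  have hE1 : E ≠ ∞ := by
    rw [hE, hY h hh]; exact expNeg_ne_top _
  let K : ℕ → ℝ≥0∞ := fun m => ∫⁻ z, expQuot m (g z) * expNeg (h z) ∂Λ
  have hK : Monotone K := fun a b hab =>
    lintegral_mono fun z => by gcongr; exact monotone_expQuot hab _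
  have hKsup : ⨆ m, K m = ∫⁻ z, g z * expNeg (h z) ∂Λ := by
    rw [← lintegral_iSup (fun m => by fun_prop)
      (fun a b hab z => by dsimp only; gcongr; exact monotone_expQuot hab _)]
    simp_rw [← ENNReal.iSup_mul, iSup_expQuot]
  -- Compare the Laplace functional at `h` and at `h + t g` with `t = 2 ^ (-m)`. From `1 - exp (-h -
  -- t g) = (1 - exp (-h)) + exp (-h) (1 - exp (-t g))`, the perturbed functional is `E exp (-t K
  -- m)`. Subtracting is legitimate because `E` is finite.
  have hpert (m : ℕ) : ∫⁻ ω, expQuot m (∑' i, g (Y i ω)) * expNeg (∑' i, h (Y i ω)) ∂μ =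
      expQuot m (K m) * E := by
    have hk : Measurable fun z => h z + (2 ^ m : ℝ≥0∞)⁻¹ * g z := by fun_prop
    have h1 : ∫⁻ ω, expNeg (∑' i, (h (Y i ω) + (2 ^ m : ℝ≥0∞)⁻¹ * g (Y i ω))) ∂μ =
        expNeg ((2 ^ m)⁻¹ * K m) * E := by
      rw [hY _ hk, hE, hY h hh, mul_comm, ← expNeg_add, ← lintegral_const_mul _ (by fun_prop),
        ← lintegral_add_left (by fun_prop)]
      congr 1
      refine lintegral_congr fun z => ?_
      rw [expNeg_add, one_sub_mul_eq (expNeg_le_one _) (expNeg_le_one _), expQuot, mul_assoc,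
        ← mul_assoc (2 ^ m)⁻¹, mul_comm (2 ^ m)⁻¹ (2 ^ m), two_pow_mul_inv, one_mul,
        mul_comm (expNeg _)]
    calc ∫⁻ ω, expQuot m (∑' i, g (Y i ω)) * expNeg (∑' i, h (Y i ω)) ∂μ
        = ∫⁻ ω, 2 ^ m * (expNeg (∑' i, h (Y i ω)) -
            expNeg (∑' i, (h (Y i ω) + (2 ^ m : ℝ≥0∞)⁻¹ * g (Y i ω)))) ∂μ := by
          refine lintegral_congr fun ω => ?_
          rw [ENNReal.tsum_add, expNeg_add, expQuot, mul_assoc, hsum,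
            ENNReal.sub_mul (fun _ _ => expNeg_ne_top _), one_mul, mul_comm (expNeg _)]
      _ = 2 ^ m * (E - expNeg ((2 ^ m)⁻¹ * K m) * E) := by
          have hm2 : Measurable fun ω => expNeg (∑' i, (h (Y i ω) +
              (2 ^ m : ℝ≥0∞)⁻¹ * g (Y i ω))) :=
            measurable_expNeg.comp (Measurable.tsum fun i => hk.comp (hm i))
          rw [lintegral_const_mul' _ _ (by simp), lintegral_sub hm2 _ _, h1]
          · rw [h1]; exact ENNReal.mul_ne_top (expNeg_ne_top _) hE1
          · exact .of_forall fun ω => expNeg_antitone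
              (ENNReal.tsum_le_tsum fun i => le_self_add)
      _ = expQuot m (K m) * E := by
          rw [expQuot, mul_assoc, ENNReal.sub_mul (fun _ _ => hE1), one_mul]
  rw [← hKsup, ← iSup_expQuot_iSup hK, ENNReal.iSup_mul]
  simp_rw [← hpert]
  rw [← lintegral_iSup (fun m => by fun_prop)
      (fun a b hab z => by dsimp only; gcongr; exact monotone_expQuot hab _)]
  simp_rw [← ENNReal.iSup_mul, iSup_expQuot]

variable {q : S → ℝ≥0∞}

lemma measurable_rest [Countable ι] (hm : ∀ i, Measurable (Y i)) (hq : Measurable q) (i : ι) :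
    Measurable (rest q Y i) := by
  classical
  exact Measurable.tsum fun j => by split_ifs <;> fun_prop

/-- The differentiated Laplace functional with `h = n q` and `g = 1_A exp (n q)`: the growing
exponential cancels the contribution of the point itself and leaves the sum over the others. The
cancellation needs `q` finite. -/
lemma lintegral_tsum_indicator_mul_expNeg_rest [Countable ι] (hY : HasPoissonLaplace μ Λ Y)
    (hm : ∀ i, Measurable (Y i)) (hq : Measurable q) (hqtop : ∀ z, q z ≠ ∞) {A : Set S}
    (hA : MeasurableSet A) (n : ℕ) :
    ∫⁻ ω, ∑' i, A.indicator 1 (Y i ω) * expNeg (n * rest q Y i ω) ∂μ =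
      Λ A * ∫⁻ ω, expNeg (n * ∑' i, q (Y i ω)) ∂μ := by
  have hne (z : S) : expNeg (n * q z) ≠ 0 := by
    rw [Ne, expNeg_eq_zero_iff]
    exact ENNReal.mul_ne_top (by simp) (hqtop z)
  have key := hY.lintegral_tsum_mul_expNeg hm
    (g := fun z => A.indicator 1 z * (expNeg (n * q z))⁻¹) (h := fun z => n * q z)
    ((measurable_one.indicator hA).mul (by fun_prop)) (by fun_prop)
  simp only [ENNReal.tsum_mul_left] at key
  have h2 : ∫⁻ z, A.indicator 1 z * (expNeg (n * q z))⁻¹ * expNeg (n * q z) ∂Λ = Λ A := by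
    rw [← lintegral_indicator_one hA]
    refine lintegral_congr fun z => ?_
    rw [mul_assoc, ENNReal.inv_mul_cancel (hne z) (expNeg_ne_top _), mul_one]
  rw [h2] at key
  rw [← key]
  refine lintegral_congr fun ω => ?_
  rw [← ENNReal.tsum_mul_right]
  refine tsum_congr fun i => ?_
  rw [tsum_eq_add_rest q Y i, mul_add, expNeg_add, mul_assoc, ← mul_assoc (_)⁻¹,
    ENNReal.inv_mul_cancel (hne _) (expNeg_ne_top _), one_mul]

/-- Mecke's formula for functions of a point and of an additive functional of the other points. -/
theorem lintegral_tsum_rest [IsProbabilityMeasure μ] [Countable ι] [SigmaFinite Λ] (hY : HasPoissonLaplace μ Λ Y)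
    (hm : ∀ i, Measurable (Y i)) (hq : Measurable q) (hqtop : ∀ z, q z ≠ ∞)
    {F : S × ℝ≥0∞ → ℝ≥0∞} (hF : Measurable F) :
    ∫⁻ ω, ∑' i, F (Y i ω, rest q Y i ω) ∂μ =
      ∫⁻ ω, ∫⁻ z, F (z, ∑' i, q (Y i ω)) ∂Λ ∂μ := by
  have hI : Measurable fun ω => ∑' i, q (Y i ω) := Measurable.tsum fun i => hq.comp (hm i)
  have hpair (i : ι) : Measurable fun ω => (Y i ω, rest q Y i ω) :=
    (hm i).prodMk (measurable_rest hm hq i)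
  let M : Measure (S × ℝ≥0∞) := Measure.sum fun i => μ.map fun ω => (Y i ω, rest q Y i ω)
  let ν : Measure ℝ≥0∞ := μ.map fun ω => ∑' i, q (Y i ω)
  have hM (G : S × ℝ≥0∞ → ℝ≥0∞) (hG : Measurable G) :
      ∫⁻ p, G p ∂M = ∫⁻ ω, ∑' i, G (Y i ω, rest q Y i ω) ∂μ := by
    have hGm (i : ι) : AEMeasurable (fun ω => G (Y i ω, rest q Y i ω)) μ :=
      (hG.comp (hpair i)).aemeasurable
    rw [lintegral_sum_measure, lintegral_tsum hGm]
    exact tsum_congr fun i => lintegral_map hG (hpair i)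
  have : IsProbabilityMeasure ν := Measure.isProbabilityMeasure_map hI.aemeasurable
  -- It suffices to compare both measures on rectangles `A ×ˢ B` with `Λ A` finite; these generate
  -- the product and exhaust it because `Λ` is σ-finite.
  have hMν : Λ.prod ν = M := by
    let C : Set (Set S) := {A | MeasurableSet A ∧ Λ A < ∞}
    have hC : IsPiSystem C := fun A hA B hB _ =>
      ⟨hA.1.inter hB.1, (measure_mono Set.inter_subset_left).trans_lt hA.2⟩
    have hspan : Λ.FiniteSpanningSetsIn C :=
      { set := spanningSets Λ
        set_mem := fun i => ⟨measurableSet_spanningSets Λ i, measure_spanningSets_lt_top Λ i⟩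
        finite := measure_spanningSets_lt_top Λ
        spanning := iUnion_spanningSets Λ }
    have hgen : MeasurableSpace.generateFrom C = ‹MeasurableSpace S› := by
      refine le_antisymm (MeasurableSpace.generateFrom_le fun A hA => hA.1) fun A hA => ?_
      have : A = ⋃ i, A ∩ spanningSets Λ i := by
        rw [← Set.inter_iUnion, iUnion_spanningSets, Set.inter_univ]
      rw [this]
      exact MeasurableSet.iUnion fun i => MeasurableSpace.measurableSet_generateFrom
        ⟨hA.inter (measurableSet_spanningSets Λ i),
          (measure_mono Set.inter_subset_right).trans_lt (measure_spanningSets_lt_top Λ i)⟩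
    refine Measure.prod_eq_generateFrom hgen MeasurableSpace.generateFrom_measurableSet hC
      MeasurableSpace.isPiSystem_measurableSet hspan ν.toFiniteSpanningSetsIn ?_
    rintro A ⟨hA, hAfin⟩ B hB
    replace hB : MeasurableSet B := hB
    -- For fixed `A` the second marginal over `A` is identified with `Λ A • ν` by its Laplace
    -- transforms; the case `n = 0` also gives its finiteness.
    let P : Measure ℝ≥0∞ := (M.restrict (A ×ˢ Set.univ)).map Prod.snd
    have hP (G : ℝ≥0∞ → ℝ≥0∞) (hG : Measurable G) :
        ∫⁻ y, G y ∂P = ∫⁻ ω, ∑' i, A.indicator 1 (Y i ω) * G (rest q Y i ω) ∂μ := by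
      rw [lintegral_map hG measurable_snd, ← lintegral_indicator (hA.prod .univ), hM]
      · refine lintegral_congr fun ω => tsum_congr fun i => ?_
        by_cases h : Y i ω ∈ A <;> simp [h]
      · exact (hG.comp measurable_snd).indicator (hA.prod .univ)
    have hexp (n : ℕ) : ∫⁻ y, expNeg (n * y) ∂P = ∫⁻ y, expNeg (n * y) ∂(Λ A • ν) := by
      rw [hP _ (by fun_prop), hY.lintegral_tsum_indicator_mul_expNeg_rest hm hq hqtop hA,
        lintegral_smul_measure, lintegral_map (by fun_prop) hI, smul_eq_mul]
    have : IsFiniteMeasure (Λ A • ν) := Measure.smul_finite _ hAfin.ne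
    have : IsFiniteMeasure P := ⟨by
      have := hexp 0
      simp only [Nat.cast_zero, zero_mul, expNeg_zero, lintegral_one] at this
      rw [this]; exact measure_lt_top _ _⟩
    have hPν : P = Λ A • ν := measure_eq_of_lintegral_expNeg hexp
    have : P B = Λ A * ν B := by rw [hPν]; rfl
    rw [← this, Measure.map_apply measurable_snd hB, Measure.restrict_apply (measurable_snd hB)]
    congr 1
    ext p
    simp [and_comm]
  rw [← hM F hF, ← hMν, lintegral_prod_symm' F hF, lintegral_map hF.lintegral_prod_left' hI]

end HasPoissonLaplace

/-! ### The Laplace functional of a planar Poisson process -/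

lemma lintegral_expNeg_poissonMeasure (r : ℝ≥0) (c : ℝ≥0∞) :
    ∫⁻ n : ℕ, expNeg (c * n) ∂poissonMeasure r = expNeg ((1 - expNeg c) * r) := by
  set v := expNeg c with hv
  have hv1 : v ≤ 1 := expNeg_le_one c
  have hn (n : ℕ) : expNeg (c * n) = v ^ n := by rw [mul_comm, expNeg_nat_mul]
  obtain ⟨w, hw⟩ : ∃ w : ℝ≥0, v = w := ⟨v.toNNReal, (ENNReal.coe_toNNReal (expNeg_ne_top c)).symm⟩
  rw [hw] at hn hv1 ⊢
  have hw1 : (w : ℝ) ≤ 1 := by exact_mod_cast hv1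
  have hR : (1 - (w : ℝ≥0∞)) * r = ENNReal.ofReal ((1 - w) * r) := by
    rw [ENNReal.ofReal_mul (by linarith), ENNReal.ofReal_sub _ w.coe_nonneg]; simp
  rw [hR, expNeg_ofReal (mul_nonneg (by linarith) r.coe_nonneg), poissonMeasure,
    lintegral_sum_measure]
  simp_rw [lintegral_smul_measure, lintegral_dirac, hn, smul_eq_mul]
  have hterm (n : ℕ) : ENNReal.ofReal (Real.exp (-r) * r ^ n / n.factorial) * (w : ℝ≥0∞) ^ n =
      ENNReal.ofReal (Real.exp (-r) * ((r * w) ^ n / n.factorial)) := by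
    rw [← ENNReal.ofReal_coe_nnreal, ← ENNReal.ofReal_pow w.coe_nonneg,
      ← ENNReal.ofReal_mul (by positivity)]
    congr 1
    rw [mul_pow]; ring
  have hs : HasSum (fun n : ℕ => ((r : ℝ) * w) ^ n / n.factorial) (Real.exp (r * w)) := by
    rw [Real.exp_eq_exp_ℝ]; exact NormedSpace.expSeries_div_hasSum_exp _
  have hs' := hs.mul_left (Real.exp (-r))
  rw [tsum_congr hterm, ← ENNReal.ofReal_tsum_of_nonneg (fun n => by positivity) hs'.summable,
    hs'.tsum_eq, ← Real.exp_add]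
  congr 2
  ring

lemma lintegral_pointMeasure {Ω : Type*} (X : ℕ → Ω → Plane) {f : Plane → ℝ≥0∞}
    (hf : Measurable f) (ω : Ω) : ∫⁻ x, f x ∂pointMeasure X ω = ∑' n, f (X n ω) := by
  rw [pointMeasure, lintegral_sum_measure]
  simp_rw [lintegral_dirac' _ hf]

-- Dominated convergence by `1` on the left and monotone convergence on the right carry the formula
-- to increasing limits.
open Filter Topology in
lemma laplace_of_iSup {Ω S : Type*} [MeasurableSpace Ω] [MeasurableSpace S] {μ : Measure Ω}
    [IsProbabilityMeasure μ] {Λ : Measure S} {Y : ℕ → Ω → S} (hY : ∀ n, Measurable (Y n))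
    {h : ℕ → S → ℝ≥0∞} (hh : ∀ m, Measurable (h m)) (hmono : Monotone h)
    (hlap : ∀ m, ∫⁻ ω, expNeg (∑' n, h m (Y n ω)) ∂μ =
      expNeg (∫⁻ z, (1 - expNeg (h m z)) ∂Λ)) :
    ∫⁻ ω, expNeg (∑' n, (⨆ m, h m (Y n ω))) ∂μ =
      expNeg (∫⁻ z, (1 - expNeg (⨆ m, h m z)) ∂Λ) := by
  have h1 : Tendsto (fun m => ∫⁻ ω, expNeg (∑' n, h m (Y n ω)) ∂μ) atTop
      (𝓝 (∫⁻ ω, expNeg (∑' n, (⨆ m, h m (Y n ω))) ∂μ)) := by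
    refine tendsto_lintegral_of_dominated_convergence (fun _ => 1) (fun m => ?_)
      (fun m => .of_forall fun ω => expNeg_le_one _) (by simp) (.of_forall fun ω => ?_)
    · exact measurable_expNeg.comp (Measurable.tsum fun n => (hh m).comp (hY n))
    · refine (continuous_expNeg.tendsto _).comp ?_
      have h2 : ∑' n, (⨆ m, h m (Y n ω)) = ⨆ m, ∑' n, h m (Y n ω) := by
        simp_rw [← lintegral_count]
        exact lintegral_iSup (fun m => measurable_from_nat) fun a b hab n => hmono hab _
      rw [h2]
      exact tendsto_atTop_iSup fun a b hab => ENNReal.tsum_le_tsum fun n => hmono hab _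
  have h2 : Tendsto (fun m => expNeg (∫⁻ z, (1 - expNeg (h m z)) ∂Λ)) atTop
      (𝓝 (expNeg (∫⁻ z, (1 - expNeg (⨆ m, h m z)) ∂Λ))) := by
    refine (continuous_expNeg.tendsto _).comp ?_
    refine lintegral_tendsto_of_tendsto_of_monotone (fun m => by fun_prop)
      (.of_forall fun z a b hab => tsub_le_tsub_left (expNeg_antitone (hmono hab z)) _)
      (.of_forall fun z => ?_)
    refine ENNReal.Tendsto.sub tendsto_const_nhds
      ((continuous_expNeg.tendsto _).comp (tendsto_atTop_iSup fun a b hab => hmono hab z))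
      (by simp)
  simp_rw [hlap] at h1
  exact tendsto_nhds_unique h1 h2

namespace IsPoissonProcess

variable {Ω : Type*} [MeasurableSpace Ω] {μ : Measure Ω} {lam : ℝ≥0} {X : ℕ → Ω → Plane}

lemma measurable_count (hX : IsPoissonProcess μ lam X) {B : Set Plane} (hB : MeasurableSet B) :
    Measurable fun ω => pointMeasure X ω B := by
  have (ω : Ω) : pointMeasure X ω B = ∑' n, B.indicator 1 (X n ω) := by
    rw [← lintegral_pointMeasure X (measurable_one.indicator hB), lintegral_indicator_one hB]
  simp_rw [this]
  exact Measurable.tsum fun n => (measurable_one.indicator hB).comp (hX.measurable n)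

lemma lintegral_expNeg_count (hX : IsPoissonProcess μ lam X) {B : Set Plane}
    (hB : MeasurableSet B) (hfin : volume B ≠ ∞) (c : ℝ≥0∞) :
    ∫⁻ ω, expNeg (c * pointMeasure X ω B) ∂μ = expNeg ((1 - expNeg c) * (lam • volume) B) := by
  have h := hX.hasLaw_count B hB hfin
  have h1 : ∫⁻ ω, expNeg (c * pointMeasure X ω B) ∂μ =
      ∫⁻ y, expNeg (c * y) ∂(μ.map fun ω => pointMeasure X ω B) :=
    (lintegral_map' (f := fun y => expNeg (c * y)) (by fun_prop) h.aemeasurable).symm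
  rw [h1, h.map_eq, lintegral_map (by fun_prop) (by fun_prop), lintegral_expNeg_poissonMeasure]
  congr 2
  rw [ENNReal.coe_mul, ENNReal.coe_toNNReal hfin]
  rfl

/-- The sum of a simple function over the points is a combination of the counts in its disjoint
fibres, which are independent and Poisson. The fibre over `0` may have infinite area, but its factor
is `1`. -/
lemma laplace_simpleFunc [IsProbabilityMeasure μ] (hX : IsPoissonProcess μ lam X)
    (g : SimpleFunc Plane ℝ≥0∞) (hg : ∀ c ≠ 0, volume (g ⁻¹' {c}) ≠ ∞) :
    ∫⁻ ω, expNeg (∑' n, g (X n ω)) ∂μ =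
      expNeg (∫⁻ z, (1 - expNeg (g z)) ∂(lam • volume)) := by
  let e := g.range.equivFin
  have hind : iIndepFun (fun (c : g.range) ω => pointMeasure X ω (g ⁻¹' {(c : ℝ≥0∞)})) μ := by
    have h := hX.indep_count _ (fun i => g ⁻¹' {((e.symm i : g.range) : ℝ≥0∞)})
      (fun i => g.measurableSet_fiber _) (fun i j hij => by
        refine Set.disjoint_left.2 fun x hx hx' => hij (e.symm.injective (Subtype.ext ?_))
        exact hx.symm.trans hx')
    simpa using h.precomp e.injective
  have h1 (ω : Ω) : expNeg (∑' n, g (X n ω)) =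
      ∏ c : g.range, expNeg (c * pointMeasure X ω (g ⁻¹' {(c : ℝ≥0∞)})) := by
    rw [← lintegral_pointMeasure X g.measurable, SimpleFunc.lintegral_eq_lintegral,
      SimpleFunc.lintegral, ← Finset.sum_coe_sort, expNeg_sum]
  have h2 : ∫⁻ z, (1 - expNeg (g z)) ∂(lam • volume) =
      ∑ c : g.range, (1 - expNeg c) * (lam • volume) (g ⁻¹' {(c : ℝ≥0∞)}) := by
    have : ∀ z, 1 - expNeg (g z) = g.map (fun c => 1 - expNeg c) z := fun z => rfl
    simp_rw [this]
    rw [SimpleFunc.lintegral_eq_lintegral, SimpleFunc.map_lintegral, ← Finset.sum_coe_sort]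
  have hind' := hind.comp (fun c y => expNeg (c * y)) fun c => by fun_prop
  simp_rw [h1]
  rw [h2, expNeg_sum]
  refine (lintegral_prod_eq_prod_lintegral_of_indepFun _ _ hind' fun c => ?_).trans ?_
  · exact (by fun_prop : Measurable fun y => expNeg ((c : ℝ≥0∞) * y)).comp
      (hX.measurable_count (g.measurableSet_fiber _))
  · refine Finset.prod_congr rfl fun c _ => ?_
    by_cases hc : (c : ℝ≥0∞) = 0
    · simp [hc]
    · exact hX.lintegral_expNeg_count (g.measurableSet_fiber _) (hg _ hc) c

/-- The Laplace functional of a Poisson process. -/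
theorem hasPoissonLaplace [IsProbabilityMeasure μ] (hX : IsPoissonProcess μ lam X) :
    HasPoissonLaplace μ (lam • volume) X := by
  intro h hh
  let A := spanningSets (volume : Measure Plane)
  -- Truncation to sets of finite area makes the fibres over nonzero values have finite area and
  -- keeps the sequence increasing to `h`.
  let f : ℕ → SimpleFunc Plane ℝ≥0∞ := fun m => (SimpleFunc.eapprox h m).restrict (A m)
  have hA (m : ℕ) : MeasurableSet (A m) := measurableSet_spanningSets _ m
  have hf (m : ℕ) (x : Plane) : f m x = (A m).indicator (SimpleFunc.eapprox h m) x := by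
    simp only [f, SimpleFunc.restrict_apply _ (hA m)]
  have hmono : Monotone fun m => (f m : Plane → ℝ≥0∞) := fun a b hab x => by
    simp only [hf]
    exact (Set.indicator_le_indicator_of_subset (monotone_spanningSets _ hab)
      (fun _ => zero_le) x).trans
      (Set.indicator_le_indicator (SimpleFunc.monotone_eapprox h hab x))
  have hsup (x : Plane) : ⨆ m, f m x = h x := by
    rw [← SimpleFunc.iSup_eapprox_apply hh x]
    refine le_antisymm (iSup_mono fun m => ?_) (iSup_le fun m => ?_)
    · rw [hf]; exact Set.indicator_le_self _ _ _
    · obtain ⟨j, hj⟩ : ∃ j, x ∈ A j := by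
        have : x ∈ ⋃ j, A j := by simp [A, iUnion_spanningSets]
        simpa using this
      refine le_trans ?_ (le_iSup (fun m => f m x) (max m j))
      rw [hf, Set.indicator_of_mem (monotone_spanningSets _ (le_max_right m j) hj)]
      exact SimpleFunc.monotone_eapprox h (le_max_left m j) x
  have := laplace_of_iSup (μ := μ) (Λ := lam • volume) hX.measurable
    (h := fun m => f m) (fun m => (f m).measurable) hmono fun m =>
      hX.laplace_simpleFunc (f m) fun c hc => by
        refine ((measure_mono fun x hx => ?_).trans_lt
          (measure_spanningSets_lt_top (volume : Measure Plane) m)).ne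
        by_contra hxA
        have hx' : f m x = c := hx
        rw [hf, Set.indicator_of_notMem hxA] at hx'
        exact hc hx'.symm
  simpa only [hsup] using this

end IsPoissonProcess

/-! ### Marking by fading gains and superposition of the tiers -/

open Filter Topology in
lemma tendsto_lintegral_expNeg_sum {Ω ι : Type*} [MeasurableSpace Ω] [Countable ι]
    (μ : Measure Ω) [IsProbabilityMeasure μ] {f : ι → Ω → ℝ≥0∞} (hf : ∀ i, Measurable (f i)) :
    Tendsto (fun s : Finset ι => ∫⁻ ω, expNeg (∑ i ∈ s, f i ω) ∂μ) atTop
      (𝓝 (∫⁻ ω, expNeg (∑' i, f i ω) ∂μ)) := by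
  refine tendsto_lintegral_filter_of_dominated_convergence (fun _ => 1)
    (.of_forall fun s => ?_) (.of_forall fun s => .of_forall fun ω => expNeg_le_one _)
    (by simp) (.of_forall fun ω => ?_)
  · exact measurable_expNeg.comp (Finset.measurable_fun_sum s fun i _ => hf i)
  · exact (continuous_expNeg.tendsto _).comp ENNReal.summable.hasSum

instance (t : Tier) : IsProbabilityMeasure t.fading := t.isProbabilityMeasure_fading

namespace Network

variable {Ω : Type*} [MeasurableSpace Ω] {μ : Measure Ω} {K L : ℕ}
  {o : Fin K → Tier} {c : Fin L → Tier}

/-- The base station `p` as a marked point: its tier, its position and its fading gain. -/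
def point (N : Network μ o c) (p : (Fin K ⊕ Fin L) × ℕ) (ω : Ω) :
    (Fin K ⊕ Fin L) × Plane × ℝ :=
  (p.1, N.pos p.1 p.2 ω, N.gain p.1 p.2 ω)

/-- The intensity measure of the marked points of all tiers. -/
def intensity (o : Fin K → Tier) (c : Fin L → Tier) :
    Measure ((Fin K ⊕ Fin L) × Plane × ℝ) :=
  Measure.sum fun t => (Measure.dirac t).prod
    (((Sum.elim o c t).density • volume).prod (Sum.elim o c t).fading)

instance : SigmaFinite (intensity o c) := by
  have (t : Fin K ⊕ Fin L) :
      SigmaFinite ((Sum.elim o c t).density • (volume : Measure Plane)) :=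
    SMul.sigmaFinite _
  unfold intensity; infer_instance

lemma lintegral_intensity {f : (Fin K ⊕ Fin L) × Plane × ℝ → ℝ≥0∞} (hf : Measurable f) :
    ∫⁻ z, f z ∂(intensity o c) = ∑ t, (Sum.elim o c t).density *
      ∫⁻ x, ∫⁻ ψ, f (t, x, ψ) ∂(Sum.elim o c t).fading := by
  rw [intensity, lintegral_sum_measure, tsum_fintype]
  refine Finset.sum_congr rfl fun t _ => ?_
  rw [lintegral_prod _ hf.aemeasurable, lintegral_dirac' _ hf.lintegral_prod_right',
    lintegral_prod _ (by fun_prop), lintegral_smul_measure]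
  rfl

lemma measurable_point (N : Network μ o c) (p : (Fin K ⊕ Fin L) × ℕ) :
    Measurable (N.point p) :=
  measurable_const.prodMk (((isPoissonProcess N p.1).measurable p.2).prodMk
    (N.measurable_gain p.1 p.2))

/-- Averaging over the fading gains, given the positions. -/
lemma lintegral_expNeg_sum_point [IsProbabilityMeasure μ] (N : Network μ o c)
    {h : (Fin K ⊕ Fin L) × Plane × ℝ → ℝ≥0∞} (hh : Measurable h)
    (s : Finset ((Fin K ⊕ Fin L) × ℕ)) :
    ∫⁻ ω, expNeg (∑ p ∈ s, h (N.point p ω)) ∂μ =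
      ∫⁻ ω, expNeg (∑ p ∈ s, negLog (∫⁻ ψ, expNeg (h (p.1, N.pos p.1 p.2 ω, ψ))
        ∂(Sum.elim o c p.1).fading)) ∂μ := by
  have hpos : Measurable fun ω t n => N.pos t n ω :=
    measurable_pi_lambda _ fun t => measurable_pi_lambda _ fun n =>
      (isPoissonProcess N t).measurable n
  have hgain : Measurable fun ω t n => N.gain t n ω :=
    measurable_pi_lambda _ fun t => measurable_pi_lambda _ fun n => N.measurable_gain t n
  let F : ((Fin K ⊕ Fin L) → ℕ → Plane) × ((Fin K ⊕ Fin L) → ℕ → ℝ) → ℝ≥0∞ := fun w =>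
    expNeg (∑ p ∈ s, h (p.1, w.1 p.1 p.2, w.2 p.1 p.2))
  have hF : Measurable F := by fun_prop
  -- Independence of positions and gains turns conditioning on the positions into Tonelli's theorem;
  -- with the positions frozen, the factors of the finite product are independent.
  have hprod := (indepFun_iff_map_prod_eq_prod_map_map hpos.aemeasurable hgain.aemeasurable).1
    N.indep_pos_gain
  have h1 : ∫⁻ ω, expNeg (∑ p ∈ s, h (N.point p ω)) ∂μ =
      ∫⁻ w, F w ∂(μ.map fun ω => (fun t n => N.pos t n ω, fun t n => N.gain t n ω)) :=
    (lintegral_map hF (hpos.prodMk hgain)).symm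
  have : IsProbabilityMeasure (μ.map fun ω t n => N.gain t n ω) :=
    Measure.isProbabilityMeasure_map hgain.aemeasurable
  rw [h1, hprod, lintegral_prod _ hF.aemeasurable, lintegral_map hF.lintegral_prod_right' hpos]
  refine lintegral_congr fun ω => ?_
  rw [lintegral_map (by fun_prop) hgain]
  simp only [F, expNeg_sum]
  have hind := N.indep_gain.comp
    (fun p ψ => expNeg (h (p.1, N.pos p.1 p.2 ω, ψ))) fun p => by fun_prop
  refine (lintegral_prod_eq_prod_lintegral_of_indepFun s _ hind fun p => ?_).trans ?_
  · exact (by fun_prop : Measurable fun ψ => expNeg (h (p.1, N.pos p.1 p.2 ω, ψ))).comp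
      (N.measurable_gain p.1 p.2)
  · refine Finset.prod_congr rfl fun p _ => ?_
    rw [expNeg_negLog]
    · rw [← (N.hasLaw_gain p.1 p.2).map_eq,
        lintegral_map (by fun_prop) (N.measurable_gain p.1 p.2)]
      rfl
    · exact (lintegral_mono fun ψ => expNeg_le_one _).trans (by simp)

/-- The marked points of all tiers form a Poisson process. -/
theorem hasPoissonLaplace_point [IsProbabilityMeasure μ] (N : Network μ o c) :
    HasPoissonLaplace μ (intensity o c) N.point := by
  intro h hh
  let v : (Fin K ⊕ Fin L) → Plane → ℝ≥0∞ := fun t x =>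
    ∫⁻ ψ, expNeg (h (t, x, ψ)) ∂(Sum.elim o c t).fading
  have hv (t) : Measurable (v t) := by
    have : Measurable fun w : Plane × ℝ => expNeg (h (t, w.1, w.2)) := by fun_prop
    exact this.lintegral_prod_right'
  have hv1 (t x) : v t x ≤ 1 := (lintegral_mono fun ψ => expNeg_le_one _).trans (by simp)
  have hvp (p : (Fin K ⊕ Fin L) × ℕ) : Measurable fun ω => negLog (v p.1 (N.pos p.1 p.2 ω)) :=
    measurable_negLog.comp ((hv p.1).comp ((isPoissonProcess N p.1).measurable p.2))
  -- The average over a gain lies in `[0, 1]`, so `negLog` writes it as an exponential again. Both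
  -- sides are then limits along finite sets of stations, and the remaining expression is a Laplace
  -- functional of the positions alone.
  have h1 : ∫⁻ ω, expNeg (∑' p, h (N.point p ω)) ∂μ =
      ∫⁻ ω, expNeg (∑' p : (Fin K ⊕ Fin L) × ℕ, negLog (v p.1 (N.pos p.1 p.2 ω))) ∂μ := by
    refine tendsto_nhds_unique
      (tendsto_lintegral_expNeg_sum μ fun p => hh.comp (N.measurable_point p)) ?_
    simp_rw [N.lintegral_expNeg_sum_point hh]
    exact tendsto_lintegral_expNeg_sum μ hvp
  have hind := N.indep_pos.comp
    (fun t x => expNeg (∑' n, negLog (v t (x n)))) fun t =>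
      measurable_expNeg.comp (Measurable.tsum fun n =>
        measurable_negLog.comp ((hv t).comp (measurable_pi_apply n)))
  have h2 : ∫⁻ ω, expNeg (∑' p : (Fin K ⊕ Fin L) × ℕ, negLog (v p.1 (N.pos p.1 p.2 ω))) ∂μ =
      ∏ t, ∫⁻ ω, expNeg (∑' n, negLog (v t (N.pos t n ω))) ∂μ := by
    refine (lintegral_congr fun ω => ?_).trans
      (lintegral_prod_eq_prod_lintegral_of_indepFun Finset.univ _ hind fun t =>
        measurable_expNeg.comp (Measurable.tsum fun n => hvp (t, n)))
    rw [ENNReal.tsum_prod (f := fun t n => negLog (v t (N.pos t n ω))), tsum_fintype, expNeg_sum]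
  rw [h1, h2, lintegral_intensity (by fun_prop), expNeg_sum]
  refine Finset.prod_congr rfl fun t _ => ?_
  refine ((isPoissonProcess N t).hasPoissonLaplace (fun x => negLog (v t x))
    (measurable_negLog.comp (hv t))).trans ?_
  rw [lintegral_smul_measure]
  congr 2
  refine lintegral_congr fun x => ?_
  rw [expNeg_negLog (hv1 t x), lintegral_sub (by fun_prop)
    (ne_top_of_le_ne_top (by simp) (hv1 t x)) (.of_forall fun ψ => expNeg_le_one _)]
  simp [v]

end Network

/-! ### Mean counts and Laplace exponents of a single tier -/

/-- The area in which a base station with effective power `b` is received with power above `a`. -/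
lemma volume_lt_rxPower {e : ℝ} (he : 2 < e) (a : ℝ≥0∞) (b : ℝ) :
    volume {x : Plane | a < ENNReal.ofReal (b * ‖x‖ ^ (-e))} =
      ENNReal.ofReal Real.pi * (ENNReal.ofReal b * a⁻¹) ^ (2 / e) := by
  have he0 : 0 < e := by linarith
  have hd : 0 < 2 / e := by positivity
  rcases le_or_gt b 0 with hb | hb
  · have (x : Plane) : ENNReal.ofReal (b * ‖x‖ ^ (-e)) = 0 :=
      ENNReal.ofReal_eq_zero.2 (mul_nonpos_of_nonpos_of_nonneg hb (by positivity))
    simp [this, ENNReal.ofReal_eq_zero.2 hb, ENNReal.zero_rpow_of_pos hd]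
  rcases eq_or_ne a ∞ with rfl | ha
  · simp [ENNReal.zero_rpow_of_pos hd]
  -- At the origin `‖x‖ ^ (-e)` takes the default value `0`, so the set is a disc only up to this
  -- null set.
  have hzero : ∀ᵐ x : Plane, x ≠ 0 := by
    simp [ae_iff]
  rcases eq_or_ne a 0 with rfl | ha0
  · have h1 : volume {x : Plane | (0 : ℝ≥0∞) < ENNReal.ofReal (b * ‖x‖ ^ (-e))} =
        volume (Set.univ : Set Plane) := by
      refine measure_congr ?_
      filter_upwards [hzero] with x hx
      refine propext (iff_true_intro ?_)
      have : 0 < ‖x‖ := norm_pos_iff.2 hx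
      show (0 : ℝ≥0∞) < ENNReal.ofReal (b * ‖x‖ ^ (-e))
      rw [ENNReal.ofReal_pos]; positivity
    rw [h1, measure_univ_of_isAddLeftInvariant, ENNReal.inv_zero, ENNReal.mul_top (by simpa),
      ENNReal.top_rpow_of_pos hd, ENNReal.mul_top (by simp [Real.pi_pos])]
  lift a to ℝ≥0 using ha
  have ha' : (0 : ℝ) < a := by
    have : a ≠ 0 := by simpa using ha0
    positivity
  have h1 : volume {x : Plane | (a : ℝ≥0∞) < ENNReal.ofReal (b * ‖x‖ ^ (-e))} =
      volume (Metric.ball (0 : Plane) ((b / a) ^ (1 / e))) := by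
    refine measure_congr ?_
    filter_upwards [hzero] with x hx
    refine propext ?_
    have hx : 0 < ‖x‖ := norm_pos_iff.2 hx
    show (a : ℝ≥0∞) < ENNReal.ofReal (b * ‖x‖ ^ (-e)) ↔ x ∈ Metric.ball (0 : Plane) _
    rw [mem_ball_zero_iff, ← ENNReal.ofReal_coe_nnreal,
      ENNReal.ofReal_lt_ofReal_iff (by positivity), one_div,
      Real.lt_rpow_inv_iff_of_pos hx.le (by positivity) he0, lt_div_iff₀ ha', Real.rpow_neg hx.le,
      ← div_eq_mul_inv, lt_div_iff₀ (by positivity), mul_comm]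
  rw [h1, EuclideanSpace.volume_ball_fin_two, mul_comm, ← ENNReal.ofReal_pow (by positivity),
    ← Real.rpow_natCast, ← Real.rpow_mul (by positivity), ← ENNReal.ofReal_coe_nnreal,
    ← ENNReal.ofReal_inv_of_pos ha', ← ENNReal.ofReal_mul hb.le,
    ENNReal.ofReal_rpow_of_pos (by positivity), div_eq_mul_inv b]
  congr 3
  push_cast
  ring

lemma Tier.exponent_pos (t : Tier) : 0 < t.exponent := by linarith [t.two_lt_exponent]

lemma Tier.moment_nonneg (t : Tier) : 0 ≤ t.moment :=
  integral_nonneg_of_ae (by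
    filter_upwards [t.fading_nonneg] with x hx using Real.rpow_nonneg hx _)

lemma Tier.effDensity_nonneg (t : Tier) : 0 ≤ t.effDensity := by
  have := t.moment_nonneg
  have := t.power_pos
  unfold Tier.effDensity; positivity

lemma Tier.effDensity_pos (t : Tier) (h : 0 < t.fading (Set.Ioi 0)) : 0 < t.effDensity := by
  have hm : 0 < t.moment := by
    unfold Tier.moment
    rw [integral_pos_iff_support_of_nonneg_ae _ t.integrable_fading]
    · refine h.trans_le (measure_mono fun x hx => ?_)
      exact (Real.rpow_pos_of_pos hx _).ne'
    · filter_upwards [t.fading_nonneg] with x hx using Real.rpow_nonneg hx _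
  have := t.power_pos
  have : 0 < (t.density : ℝ) := t.density_pos
  unfold Tier.effDensity; positivity

lemma Tier.lintegral_ofReal_rpow_fading (t : Tier) :
    ∫⁻ ψ, ENNReal.ofReal ψ ^ (2 / t.exponent) ∂t.fading = ENNReal.ofReal t.moment := by
  have hd : 0 ≤ 2 / t.exponent := by have := t.exponent_pos; positivity
  rw [Tier.moment, ofReal_integral_eq_lintegral_ofReal t.integrable_fading]
  · refine lintegral_congr_ae ?_
    filter_upwards [t.fading_nonneg] with x hx
    exact ENNReal.ofReal_rpow_of_nonneg hx hd
  · filter_upwards [t.fading_nonneg] with x hx using Real.rpow_nonneg hx _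

/-- The expected number of base stations of a tier that are received with power above `a`. -/
lemma Tier.lintegral_lt_rxPower (t : Tier) (a : ℝ≥0∞) :
    t.density * ∫⁻ x : Plane, ∫⁻ ψ,
        (if a < ENNReal.ofReal (t.power * ψ * ‖x‖ ^ (-t.exponent)) then 1 else 0) ∂t.fading =
      ENNReal.ofReal (Real.pi * t.effDensity) * (a⁻¹) ^ (2 / t.exponent) := by
  have hd : 0 ≤ 2 / t.exponent := by have := t.exponent_pos; positivity
  have hP := t.power_pos
  have hmeas : Measurable fun w : Plane × ℝ =>
      ENNReal.ofReal (t.power * w.2 * ‖w.1‖ ^ (-t.exponent)) := by fun_prop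
  have hite : Measurable fun w : Plane × ℝ =>
      (if a < ENNReal.ofReal (t.power * w.2 * ‖w.1‖ ^ (-t.exponent)) then 1 else 0 : ℝ≥0∞) :=
    Measurable.ite (measurableSet_lt measurable_const hmeas) measurable_const measurable_const
  rw [lintegral_lintegral_swap hite.aemeasurable]
  have h1 (ψ : ℝ) : ∫⁻ x : Plane,
      (if a < ENNReal.ofReal (t.power * ψ * ‖x‖ ^ (-t.exponent)) then 1 else 0 : ℝ≥0∞) =
      ENNReal.ofReal ψ ^ (2 / t.exponent) * (ENNReal.ofReal Real.pi *
        ENNReal.ofReal t.power ^ (2 / t.exponent) * (a⁻¹) ^ (2 / t.exponent)) := by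
    have hs : MeasurableSet {x : Plane |
        a < ENNReal.ofReal (t.power * ψ * ‖x‖ ^ (-t.exponent))} :=
      measurableSet_lt measurable_const (by fun_prop)
    have := lintegral_indicator_one (μ := volume) hs
    rw [volume_lt_rxPower t.two_lt_exponent, ENNReal.mul_rpow_of_nonneg _ _ hd,
      ENNReal.ofReal_mul hP.le, ENNReal.mul_rpow_of_nonneg _ _ hd] at this
    simp only [Set.indicator_apply, Set.mem_ofPred_eq, Pi.one_apply] at this
    rw [this]
    ring
  simp_rw [h1]
  rw [lintegral_mul_const _ (by fun_prop), t.lintegral_ofReal_rpow_fading,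
    ENNReal.ofReal_rpow_of_pos hP, Tier.effDensity, ENNReal.ofReal_mul Real.pi_pos.le,
    ENNReal.ofReal_mul (by positivity), ENNReal.ofReal_mul (by positivity),
    ENNReal.ofReal_coe_nnreal]
  ring

/-- This is the probability that a standard exponential variable is less than `z`. It reduces
Laplace exponents to the mean number of points received above a level. -/
lemma one_sub_expNeg_eq_lintegral (z : ℝ≥0∞) :
    1 - expNeg z = ∫⁻ y in Set.Ioi (0 : ℝ), ENNReal.ofReal (Real.exp (-y)) *
      (if ENNReal.ofReal y < z then 1 else 0) := by
  have hfin (a : ℝ) : ∫⁻ y in Set.Ioi a, ENNReal.ofReal (Real.exp (-y)) =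
      ENNReal.ofReal (Real.exp (-a)) := by
    rw [← ofReal_integral_eq_lintegral_ofReal (integrableOn_exp_neg_Ioi a)
      (.of_forall fun y => (Real.exp_pos _).le), integral_exp_neg_Ioi]
  induction z with
  | top => simp [hfin]
  | coe z =>
    have h1 : ∀ y ∈ Set.Ioi (0 : ℝ), ENNReal.ofReal (Real.exp (-y)) *
        (if ENNReal.ofReal y < z then 1 else 0) =
        (Set.Iio (z : ℝ)).indicator (fun y => ENNReal.ofReal (Real.exp (-y))) y := fun y hy => by
      have : ENNReal.ofReal y < z ↔ y < z := by
        rw [← ENNReal.ofReal_coe_nnreal, ENNReal.ofReal_lt_ofReal_iff_of_nonneg hy.le]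
      by_cases h : y < z <;> simp [this, h]
    rw [setLIntegral_congr_fun measurableSet_Ioi h1, lintegral_indicator measurableSet_Iio,
      Measure.restrict_restrict measurableSet_Iio, Set.Iio_inter_Ioi]
    have h2 := lintegral_union (μ := volume)
      (f := fun y => ENNReal.ofReal (Real.exp (-y))) (measurableSet_Ioi (a := (z : ℝ)))
      (A := Set.Ioc 0 (z : ℝ)) (Set.disjoint_left.2 fun y hy hy' => not_lt.2 hy.2 hy')
    rw [Set.Ioc_union_Ioi_eq_Ioi z.coe_nonneg, hfin, hfin,
      setLIntegral_congr Ioo_ae_eq_Ioc.symm] at h2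
    rw [← ENNReal.ofReal_coe_nnreal, expNeg_ofReal z.coe_nonneg]
    refine ENNReal.sub_eq_of_eq_add (by simp) ?_
    simpa using h2

/-- The exponent of the Laplace transform of the power received from a tier. -/
lemma Tier.lintegral_one_sub_expNeg_rxPower (t : Tier) {s : ℝ} (hs : 0 < s) :
    t.density * ∫⁻ x : Plane, ∫⁻ ψ, (1 - expNeg (ENNReal.ofReal s *
        ENNReal.ofReal (t.power * ψ * ‖x‖ ^ (-t.exponent)))) ∂t.fading =
      ENNReal.ofReal (Real.pi * t.effDensity * s ^ (2 / t.exponent) *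
        Real.Gamma (1 - 2 / t.exponent)) := by
  have he := t.two_lt_exponent
  have he0 := t.exponent_pos
  have hd : 0 < 2 / t.exponent := by positivity
  have hd1 : 2 / t.exponent < 1 := (div_lt_one he0).2 he
  let Q : Plane × ℝ → ℝ≥0∞ := fun w => ENNReal.ofReal (t.power * w.2 * ‖w.1‖ ^ (-t.exponent))
  have hQ : Measurable Q := by fun_prop
  let G : (Plane × ℝ) × ℝ → ℝ≥0∞ := fun w => ENNReal.ofReal (Real.exp (-w.2)) *
    (if ENNReal.ofReal w.2 / ENNReal.ofReal s < Q w.1 then 1 else 0)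
  have hG : Measurable G := Measurable.mul (by fun_prop)
    (Measurable.ite (measurableSet_lt (by fun_prop) (by fun_prop)) measurable_const
      measurable_const)
  have h1 (w : Plane × ℝ) : 1 - expNeg (ENNReal.ofReal s * Q w) =
      ∫⁻ y in Set.Ioi (0 : ℝ), G (w, y) := by
    rw [one_sub_expNeg_eq_lintegral]
    refine lintegral_congr fun y => ?_
    have : ENNReal.ofReal y < ENNReal.ofReal s * Q w ↔
        ENNReal.ofReal y / ENNReal.ofReal s < Q w := by
      rw [ENNReal.div_lt_iff (.inl (by simpa)) (.inl (by simp)), mul_comm]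
    simp only [G, this]
  have hprod {H : Plane × ℝ → ℝ≥0∞} (hH : Measurable H) :
      ∫⁻ x : Plane, ∫⁻ ψ, H (x, ψ) ∂t.fading = ∫⁻ w, H w ∂(volume.prod t.fading) :=
    (lintegral_prod _ hH.aemeasurable).symm
  have h2 : ∫⁻ x : Plane, ∫⁻ ψ, (1 - expNeg (ENNReal.ofReal s * Q (x, ψ))) ∂t.fading =
      ∫⁻ y in Set.Ioi (0 : ℝ), ∫⁻ x : Plane, ∫⁻ ψ, G ((x, ψ), y) ∂t.fading := by
    rw [hprod (H := fun w => 1 - expNeg (ENNReal.ofReal s * Q w)) (by fun_prop)]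
    simp_rw [h1]
    rw [lintegral_lintegral_swap hG.aemeasurable]
    exact lintegral_congr fun y => (hprod (hG.comp (measurable_id.prodMk measurable_const))).symm
  -- The mean count above the level `y / s` is proportional to `(s / y) ^ (2 / ε)`, so what remains
  -- is the Euler integral for `Γ(1 - 2/ε)`, convergent because `ε > 2`.
  have h3 (y : ℝ) (hy : y ∈ Set.Ioi (0 : ℝ)) :
      t.density * ∫⁻ x : Plane, ∫⁻ ψ, G ((x, ψ), y) ∂t.fading =
      ENNReal.ofReal (Real.pi * t.effDensity * s ^ (2 / t.exponent) *
        (Real.exp (-y) * y ^ ((1 - 2 / t.exponent) - 1))) := by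
    have hy : 0 < y := hy
    have h4 := t.lintegral_lt_rxPower (ENNReal.ofReal y / ENNReal.ofReal s)
    simp only [G, Q]
    have h5 (x : Plane) : ∫⁻ ψ, ENNReal.ofReal (Real.exp (-y)) *
        (if ENNReal.ofReal y / ENNReal.ofReal s <
          ENNReal.ofReal (t.power * ψ * ‖x‖ ^ (-t.exponent)) then 1 else 0) ∂t.fading =
        ENNReal.ofReal (Real.exp (-y)) * ∫⁻ ψ,
        (if ENNReal.ofReal y / ENNReal.ofReal s <
          ENNReal.ofReal (t.power * ψ * ‖x‖ ^ (-t.exponent)) then 1 else 0) ∂t.fading :=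
      lintegral_const_mul' _ _ (by simp)
    simp_rw [h5]
    rw [lintegral_const_mul' _ _ (by simp), ← mul_assoc, mul_comm (t.density : ℝ≥0∞), mul_assoc,
      h4, ← ENNReal.ofReal_div_of_pos hs, ← ENNReal.ofReal_inv_of_pos (by positivity),
      ENNReal.ofReal_rpow_of_pos (by positivity),
      ← ENNReal.ofReal_mul (mul_nonneg Real.pi_pos.le t.effDensity_nonneg),
      ← ENNReal.ofReal_mul (Real.exp_pos _).le, inv_div, Real.div_rpow hs.le hy.le,
      sub_sub_cancel_left, Real.rpow_neg hy.le]
    congr 1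
    ring
  have hc : 0 ≤ Real.pi * t.effDensity * s ^ (2 / t.exponent) := by
    have := t.effDensity_nonneg
    positivity
  rw [h2, ← lintegral_const_mul' _ _ (by simp), setLIntegral_congr_fun measurableSet_Ioi h3,
    ← ofReal_integral_eq_lintegral_ofReal, integral_const_mul, Real.Gamma_eq_integral (by linarith)]
  · exact (Real.GammaIntegral_convergent (by linarith)).const_mul _
  · filter_upwards [ae_restrict_mem measurableSet_Ioi] with y hy
    have hy : 0 < y := hy
    simp only [Pi.zero_apply]
    positivity

/-- Euler's reflection formula together with `Γ(1 + d) = d Γ(d)`. -/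
lemma gamma_one_sub_eq {d : ℝ} (hd : 0 < d) (hd1 : d < 1) :
    Real.Gamma (1 - d) = 1 / (Real.Gamma (1 + d) * Real.sinc (Real.pi * d)) := by
  have hpd : 0 < Real.pi * d := by positivity
  have hsin : 0 < Real.sin (Real.pi * d) :=
    Real.sin_pos_of_pos_of_lt_pi hpd (by nlinarith [Real.pi_pos])
  have hG := Real.Gamma_pos_of_pos hd
  have h := Real.Gamma_mul_Gamma_one_sub d
  rw [add_comm, Real.Gamma_add_one hd.ne', Real.sinc_of_ne_zero hpd.ne']
  field_simp at h ⊢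
  linarith

/-- The negative powers as mixtures of exponentials. -/
lemma lintegral_mul_expNeg_rpow {e : ℝ} (he : 0 < e) (y : ℝ≥0∞) :
    ∫⁻ r in Set.Ioi (0 : ℝ), ENNReal.ofReal (2 * Real.pi * r) *
        expNeg (ENNReal.ofReal (r ^ e) * y) =
      ENNReal.ofReal (Real.pi * Real.Gamma (1 + 2 / e)) * (y⁻¹) ^ (2 / e) := by
  have hd : 0 < 2 / e := by positivity
  have hG : 0 < Real.Gamma (1 + 2 / e) := Real.Gamma_pos_of_pos (by positivity)
  rcases eq_or_ne y ∞ with rfl | hy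
  · rw [ENNReal.inv_top, ENNReal.zero_rpow_of_pos hd, mul_zero]
    refine (setLIntegral_congr_fun measurableSet_Ioi fun r hr => ?_).trans lintegral_zero
    have hr : 0 < r := hr
    have : 0 < r ^ e := by positivity
    simp [ENNReal.mul_top, this]
  rcases eq_or_ne y 0 with rfl | hy0
  · rw [ENNReal.inv_zero, ENNReal.top_rpow_of_pos hd, ENNReal.mul_top (by simp; positivity),
      eq_top_iff]
    -- For `y = 0` both sides are infinite: the integrand is at least `1` on `(1, ∞)`.
    calc (∞ : ℝ≥0∞) = ∫⁻ r in Set.Ioi (1 : ℝ), 1 := by simp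
      _ ≤ ∫⁻ r in Set.Ioi (1 : ℝ), ENNReal.ofReal (2 * Real.pi * r) *
          expNeg (ENNReal.ofReal (r ^ e) * 0) := by
        refine setLIntegral_mono' measurableSet_Ioi fun r hr => ?_
        have hr : 1 < r := hr
        rw [mul_zero, expNeg_zero, mul_one, ENNReal.one_le_ofReal]
        nlinarith [Real.pi_gt_three]
      _ ≤ _ := lintegral_mono_set (Set.Ioi_subset_Ioi zero_le_one)
  lift y to ℝ≥0 using hy
  have hy' : (0 : ℝ) < y := by
    have : y ≠ 0 := by simpa using hy0
    positivity
  have h1 : ∀ r ∈ Set.Ioi (0 : ℝ), ENNReal.ofReal (2 * Real.pi * r) *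
      expNeg (ENNReal.ofReal (r ^ e) * y) =
      ENNReal.ofReal (2 * Real.pi * (r ^ (1 : ℝ) * Real.exp (-(y : ℝ) * r ^ e))) := fun r hr => by
    have hr : 0 < r := hr
    rw [← ENNReal.ofReal_coe_nnreal, ← ENNReal.ofReal_mul (by positivity),
      expNeg_ofReal (by positivity), ← ENNReal.ofReal_mul (by positivity), Real.rpow_one]
    congr 1
    rw [mul_assoc, neg_mul, mul_comm (r ^ e)]
  rw [setLIntegral_congr_fun measurableSet_Ioi h1, ← ofReal_integral_eq_lintegral_ofReal,
    integral_const_mul, integral_rpow_mul_exp_neg_mul_rpow he (by norm_num) hy',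
    ← ENNReal.ofReal_coe_nnreal, ← ENNReal.ofReal_inv_of_pos hy',
    ENNReal.ofReal_rpow_of_pos (by positivity), ← ENNReal.ofReal_mul (by positivity)]
  · congr 1
    rw [add_comm 1 (2 / e), Real.Gamma_add_one hd.ne', one_add_one_eq_two, Real.inv_rpow hy'.le,
      neg_div, Real.rpow_neg hy'.le]
    ring
  · exact (integrableOn_rpow_mul_exp_neg_mul_rpow (by norm_num) he hy').const_mul _
  · filter_upwards [ae_restrict_mem measurableSet_Ioi] with r hr
    have hr : 0 < r := hr
    simp only [Pi.zero_apply]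
    positivity

/-! ### Total received power and the coverage event -/

namespace Network

variable {Ω : Type*} [MeasurableSpace Ω] {μ : Measure Ω} {K L : ℕ}
  {o : Fin K → Tier} {c : Fin L → Tier}

/-- The power received from a marked point. -/
def markPower (o : Fin K → Tier) (c : Fin L → Tier) (z : (Fin K ⊕ Fin L) × Plane × ℝ) : ℝ≥0∞ :=
  ENNReal.ofReal ((Sum.elim o c z.1).power * z.2.2 * ‖z.2.1‖ ^ (-(Sum.elim o c z.1).exponent))

lemma measurable_markPower : Measurable (markPower o c) := by
  have h1 : Measurable fun z : (Fin K ⊕ Fin L) × Plane × ℝ => (Sum.elim o c z.1).power :=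
    (measurable_fun_sum (f := fun t => (Sum.elim o c t).power) .of_discrete .of_discrete).comp measurable_fst
  have h2 : Measurable fun z : (Fin K ⊕ Fin L) × Plane × ℝ => (Sum.elim o c z.1).exponent :=
    (measurable_fun_sum (f := fun t => (Sum.elim o c t).exponent) .of_discrete .of_discrete).comp measurable_fst
  unfold markPower
  fun_prop

lemma markPower_ne_top (z : (Fin K ⊕ Fin L) × Plane × ℝ) : markPower o c z ≠ ∞ :=
  ENNReal.ofReal_ne_top

lemma interference_eq_rest (N : Network μ o c) (k : Fin K) (i : ℕ) (ω : Ω) :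
    N.interference k i ω = rest (markPower o c) N.point (Sum.inl k, i) ω := by
  unfold interference rest
  congr! 3

/-- The total power received from all tiers. -/
def totalPower (N : Network μ o c) (ω : Ω) : ℝ≥0∞ := ∑' p, markPower o c (N.point p ω)

lemma measurable_totalPower (N : Network μ o c) : Measurable N.totalPower :=
  Measurable.tsum fun p => measurable_markPower.comp (N.measurable_point p)

lemma interferenceExponent_eq {m : ℕ} (t : Fin m → Tier) (e : ℝ) {r : ℝ} (hr : 0 < r) :
    interferenceExponent t e r = ∑ l, Real.pi * (t l).effDensity *
      (r ^ e) ^ (2 / (t l).exponent) * Real.Gamma (1 - 2 / (t l).exponent) := by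
  refine Finset.sum_congr rfl fun l _ => ?_
  have he := (t l).exponent_pos
  rw [gamma_one_sub_eq (by positivity) ((div_lt_one he).2 (t l).two_lt_exponent),
    ← Real.rpow_mul hr.le]
  ring_nf

lemma laplaceExponent_nonneg (t : Tier) {s : ℝ} (hs : 0 < s) :
    0 ≤ Real.pi * t.effDensity * s ^ (2 / t.exponent) * Real.Gamma (1 - 2 / t.exponent) := by
  have he := t.exponent_pos
  have hd1 : 2 / t.exponent < 1 := (div_lt_one he).2 t.two_lt_exponent
  have ha := t.effDensity_nonneg
  have : 0 < Real.Gamma (1 - 2 / t.exponent) := Real.Gamma_pos_of_pos (by linarith)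
  positivity

lemma interferenceExponent_nonneg {m : ℕ} (t : Fin m → Tier) (e : ℝ) {r : ℝ} (hr : 0 < r) :
    0 ≤ interferenceExponent t e r := by
  rw [interferenceExponent_eq t e hr]
  exact Finset.sum_nonneg fun l _ => laplaceExponent_nonneg _ (by positivity)

/-- The Laplace transform of the total received power. -/
lemma lintegral_expNeg_totalPower [IsProbabilityMeasure μ] (N : Network μ o c) (e : ℝ) {r : ℝ}
    (hr : 0 < r) :
    ∫⁻ ω, expNeg (ENNReal.ofReal (r ^ e) * N.totalPower ω) ∂μ =
      expNeg (ENNReal.ofReal (interferenceExponent c e r + interferenceExponent o e r)) := by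
  have hs : 0 < r ^ e := by positivity
  have h := N.hasPoissonLaplace_point (fun z => ENNReal.ofReal (r ^ e) * markPower o c z)
    (measurable_markPower.const_mul _)
  simp only [ENNReal.tsum_mul_left] at h
  have hm : Measurable fun z => 1 - expNeg (ENNReal.ofReal (r ^ e) * markPower o c z) :=
    measurable_const.sub (measurable_expNeg.comp (measurable_markPower.const_mul _))
  rw [lintegral_intensity hm] at h
  refine h.trans (congrArg expNeg ?_)
  have h1 (t : Fin K ⊕ Fin L) := (Sum.elim o c t).lintegral_one_sub_expNeg_rxPower hs
  simp only [markPower, h1]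
  rw [interferenceExponent_eq c e hr, interferenceExponent_eq o e hr, Fintype.sum_sum_type,
    ENNReal.ofReal_add, ENNReal.ofReal_sum_of_nonneg, ENNReal.ofReal_sum_of_nonneg, add_comm]
  · rfl
  all_goals first
    | exact fun l _ => laplaceExponent_nonneg _ hs
    | exact Finset.sum_nonneg fun l _ => laplaceExponent_nonneg _ hs

lemma measurable_radialIntegrand (η e : ℝ) : Measurable (radialIntegrand o c η e) := by
  unfold radialIntegrand interferenceExponent
  fun_prop

lemma radialIntegrand_nonneg {η e r : ℝ} (hr : 0 < r) : 0 ≤ radialIntegrand o c η e r := by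
  unfold radialIntegrand; positivity

/-- The negative moments of the total received power and noise. -/
lemma lintegral_totalPower_rpow [IsProbabilityMeasure μ] (N : Network μ o c) {η e : ℝ}
    (hη : 0 ≤ η) (he : 0 < e) :
    ENNReal.ofReal (Real.pi * Real.Gamma (1 + 2 / e)) *
        ∫⁻ ω, ((N.totalPower ω + ENNReal.ofReal η)⁻¹) ^ (2 / e) ∂μ =
      ∫⁻ r in Set.Ioi (0 : ℝ), ENNReal.ofReal (radialIntegrand o c η e r) := by
  have hI := N.measurable_totalPower
  rw [← lintegral_const_mul _ (by fun_prop)]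
  -- After Tonelli the deterministic noise splits off as `exp (-η r ^ e)`, leaving the Laplace
  -- transform of the total power at `r ^ e`.
  simp_rw [← lintegral_mul_expNeg_rpow he]
  rw [lintegral_lintegral_swap (by fun_prop)]
  refine setLIntegral_congr_fun measurableSet_Ioi fun r hr => ?_
  have hr : 0 < r := hr
  have hs : 0 < r ^ e := by positivity
  have h1 := interferenceExponent_nonneg c e hr
  have h2 := interferenceExponent_nonneg o e hr
  simp_rw [mul_add, expNeg_add]
  rw [lintegral_const_mul _ (by fun_prop), lintegral_mul_const _ (by fun_prop),
    N.lintegral_expNeg_totalPower e hr, ← ENNReal.ofReal_mul hs.le, ← expNeg_add,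
    ← ENNReal.ofReal_add (by positivity) (by positivity), expNeg_ofReal (by positivity),
    ← ENNReal.ofReal_mul (by positivity), radialIntegrand]
  congr 3
  ring

lemma lt_sinr_iff (N : Network μ o c) {η b : ℝ} (hb : 0 < b) (k : Fin K) (i : ℕ) (ω : Ω) :
    ENNReal.ofReal b < N.sinr η k i ω ↔
      ENNReal.ofReal b * (N.interference k i ω + ENNReal.ofReal η) <
        N.rxPower (Sum.inl k) i ω := by
  have hb' : 0 < ENNReal.ofReal b := by simpa
  have hQ : N.rxPower (Sum.inl k) i ω ≠ ∞ := ENNReal.ofReal_ne_top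
  unfold sinr
  set Y := N.interference k i ω + ENNReal.ofReal η
  set Q := N.rxPower (Sum.inl k) i ω
  -- With zero denominator the conventions `0 / 0 = 0` and `Q / 0 = ∞` for `Q ≠ 0` agree with the
  -- multiplied form.
  rcases eq_or_ne Y 0 with hY | hY
  · rcases eq_or_ne Q 0 with hQ0 | hQ0
    · simp [hY, hQ0]
    · simp [hY, hQ0, ENNReal.div_zero, pos_iff_ne_zero]
  · rw [ENNReal.lt_div_iff_mul_lt (.inl hY) (.inr hb'.ne')]

lemma rxPower_le_interference (N : Network μ o c) {k : Fin K} {i : ℕ}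
    {p : (Fin K ⊕ Fin L) × ℕ} (hp : p ≠ (Sum.inl k, i)) (ω : Ω) :
    N.rxPower p.1 p.2 ω ≤ N.interference k i ω := by
  refine le_trans ?_ (ENNReal.le_tsum p)
  rw [if_neg hp]

/-- The only use of the threshold being at least `1` rather than merely positive: `I ≤ b (I + η) <
Q`. -/
lemma interference_lt_rxPower (N : Network μ o c) {η b : ℝ} (hb : 1 ≤ b) {k : Fin K} {i : ℕ}
    {ω : Ω} (h : ENNReal.ofReal b < N.sinr η k i ω) :
    N.interference k i ω < N.rxPower (Sum.inl k) i ω := by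
  rw [N.lt_sinr_iff (by linarith)] at h
  refine lt_of_le_of_lt ?_ h
  calc N.interference k i ω ≤ 1 * (N.interference k i ω + ENNReal.ofReal η) := by
        rw [one_mul]; exact le_self_add
    _ ≤ _ := by gcongr; simpa using hb

/-- For thresholds of at least `1`, only the base station with the maximum received power can
cover the mobile station. -/
theorem coverageMaxSINR_eq_coverageMIRP (N : Network μ o c) (η : ℝ) {β : Fin K → ℝ}
    (hβ : ∀ k, 1 ≤ β k) : N.coverageMaxSINR η β = N.coverageMIRP η β := by
  unfold coverageMaxSINR coverageMIRP
  congr 1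
  ext ω
  refine exists_congr fun k => exists_congr fun i => ⟨fun h => ⟨fun l j => ?_, h⟩, fun h => h.2⟩
  by_cases hp : ((Sum.inl l, j) : (Fin K ⊕ Fin L) × ℕ) = (Sum.inl k, i)
  · simp only [Prod.mk.injEq, Sum.inl.injEq] at hp
    rw [hp.1, hp.2]
  · exact (N.rxPower_le_interference hp ω).trans (N.interference_lt_rxPower (hβ k) h).le

/-- The indicator that a marked point of an open-access tier covers the mobile station, when `y` is
the power received from the other points. -/
def coverIndicator (o : Fin K → Tier) (c : Fin L → Tier) (η : ℝ) (β : Fin K → ℝ)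
    (w : ((Fin K ⊕ Fin L) × Plane × ℝ) × ℝ≥0∞) : ℝ≥0∞ :=
  Sum.elim (fun _ => 1) (fun _ => 0) w.1.1 *
    (if Sum.elim (fun k => ENNReal.ofReal (β k)) (fun _ => 0) w.1.1 *
      (w.2 + ENNReal.ofReal η) < markPower o c w.1 then 1 else 0)

lemma measurable_coverIndicator (η : ℝ) (β : Fin K → ℝ) :
    Measurable (coverIndicator o c η β) := by
  have h1 : Measurable (Sum.elim (fun _ => 1) (fun _ => 0) : Fin K ⊕ Fin L → ℝ≥0∞) :=
    measurable_fun_sum .of_discrete .of_discrete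
  have h2 : Measurable
      (Sum.elim (fun k => ENNReal.ofReal (β k)) (fun _ => 0) : Fin K ⊕ Fin L → ℝ≥0∞) :=
    measurable_fun_sum .of_discrete .of_discrete
  have h3 := measurable_markPower (o := o) (c := c)
  exact (h1.comp (measurable_fst.comp measurable_fst)).mul
    (Measurable.ite (measurableSet_lt (by fun_prop) (by fun_prop)) measurable_const
      measurable_const)

lemma coverIndicator_inl_mk (η : ℝ) (β : Fin K → ℝ) (k : Fin K) (x : Plane) (ψ : ℝ)
    (y : ℝ≥0∞) :
    coverIndicator o c η β ((Sum.inl k, x, ψ), y) =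
      if ENNReal.ofReal (β k) * (y + ENNReal.ofReal η) <
        ENNReal.ofReal ((o k).power * ψ * ‖x‖ ^ (-(o k).exponent)) then 1 else 0 := by
  simp only [coverIndicator, markPower, Sum.elim_inl, one_mul]
  congr

lemma coverIndicator_inr_mk (η : ℝ) (β : Fin K → ℝ) (l : Fin L) (x : Plane) (ψ : ℝ)
    (y : ℝ≥0∞) : coverIndicator o c η β ((Sum.inr l, x, ψ), y) = 0 := by
  simp [coverIndicator]

open Classical in
lemma coverIndicator_inl (N : Network μ o c) {η : ℝ} {β : Fin K → ℝ} (hβ : ∀ k, 1 ≤ β k)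
    (k : Fin K) (i : ℕ) (ω : Ω) :
    coverIndicator o c η β
        (N.point (Sum.inl k, i) ω, rest (markPower o c) N.point (Sum.inl k, i) ω) =
      if ENNReal.ofReal (β k) < N.sinr η k i ω then 1 else 0 := by
  rw [← interference_eq_rest, point, coverIndicator_inl_mk]
  have := N.lt_sinr_iff (η := η) (b := β k) (by linarith [hβ k]) k i ω
  simp only [this, rxPower, Sum.elim_inl]

/-- At most one base station covers the mobile station. -/
lemma tsum_coverIndicator (N : Network μ o c) {η : ℝ} {β : Fin K → ℝ} (hβ : ∀ k, 1 ≤ β k)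
    (ω : Ω) :
    ∑' p, coverIndicator o c η β (N.point p ω, rest (markPower o c) N.point p ω) =
      {ω | ∃ k i, ENNReal.ofReal (β k) < N.sinr η k i ω}.indicator 1 ω := by
  classical
  by_cases h : ω ∈ {ω | ∃ k i, ENNReal.ofReal (β k) < N.sinr η k i ω}
  · rw [Set.indicator_of_mem h]
    obtain ⟨k, i, hki⟩ := h
    rw [tsum_eq_single (Sum.inl k, i), N.coverIndicator_inl hβ, if_pos hki, Pi.one_apply]
    rintro ⟨l | l, j⟩ hp
    · rw [N.coverIndicator_inl hβ, if_neg]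
      intro hlj
      have h1 := N.rxPower_le_interference hp ω
      have h2 := N.rxPower_le_interference (Ne.symm hp) ω
      -- Two covering stations would each be strictly stronger than the other, since each one's
      -- power is part of the other's interference.
      exact absurd (((N.interference_lt_rxPower (hβ k) hki).trans_le h2).trans
        ((N.interference_lt_rxPower (hβ l) hlj).trans_le h1)) (lt_irrefl _)
    · exact coverIndicator_inr_mk η β l _ _ _
  · rw [Set.indicator_of_notMem h, ENNReal.tsum_eq_zero]
    rintro ⟨l | l, j⟩
    · rw [N.coverIndicator_inl hβ, if_neg fun hlj => h ⟨l, j, hlj⟩]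
    · exact coverIndicator_inr_mk η β l _ _ _

lemma measurableSet_coverage (N : Network μ o c) {η : ℝ} {β : Fin K → ℝ} (hβ : ∀ k, 1 ≤ β k) :
    MeasurableSet {ω | ∃ k i, ENNReal.ofReal (β k) < N.sinr η k i ω} := by
  have h : {ω | ∃ k i, ENNReal.ofReal (β k) < N.sinr η k i ω} =
      ⋃ k, ⋃ i, {ω | ENNReal.ofReal (β k) * (N.interference k i ω + ENNReal.ofReal η) <
        N.rxPower (Sum.inl k) i ω} := by
    ext ω
    simp only [Set.mem_ofPred_eq, Set.mem_iUnion]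
    exact exists_congr fun k => exists_congr fun i => N.lt_sinr_iff (by linarith [hβ k]) k i ω
  rw [h]
  refine MeasurableSet.iUnion fun k => MeasurableSet.iUnion fun i => ?_
  have h1 : Measurable (N.interference k i) := by
    rw [funext (N.interference_eq_rest k i)]
    exact HasPoissonLaplace.measurable_rest N.measurable_point measurable_markPower _
  have h2 : Measurable (N.rxPower (Sum.inl k) i) :=
    measurable_markPower.comp (N.measurable_point (Sum.inl k, i))
  exact measurableSet_lt (by fun_prop) h2

/-- The probability of coverage, with values in `[0, ∞]`. -/
theorem measure_coverage [IsProbabilityMeasure μ] (N : Network μ o c) {η : ℝ} (hη : 0 ≤ η)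
    {β : Fin K → ℝ} (hβ : ∀ k, 1 ≤ β k) :
    μ {ω | ∃ k i, ENNReal.ofReal (β k) < N.sinr η k i ω} =
      ∑ k, ENNReal.ofReal ((o k).effDensity * β k ^ (-(2 / (o k).exponent)) /
          Real.Gamma (1 + 2 / (o k).exponent)) *
        ∫⁻ r in Set.Ioi (0 : ℝ), ENNReal.ofReal (radialIntegrand o c η (o k).exponent r) := by
  have hI := N.measurable_totalPower
  rw [← lintegral_indicator_one (N.measurableSet_coverage hβ)]
  simp_rw [← N.tsum_coverIndicator hβ]
  rw [N.hasPoissonLaplace_point.lintegral_tsum_rest N.measurable_point measurable_markPower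
    markPower_ne_top (measurable_coverIndicator η β)]
  -- After Mecke's formula the total power is a constant for the inner integral, which is the mean
  -- number of open-access points received above `β k` times total power plus noise.
  have h1 (ω : Ω) : ∫⁻ z, coverIndicator o c η β (z, N.totalPower ω) ∂(intensity o c) = ∑ k, ENNReal.ofReal (Real.pi * (o k).effDensity *
        β k ^ (-(2 / (o k).exponent))) *
        ((N.totalPower ω + ENNReal.ofReal η)⁻¹) ^ (2 / (o k).exponent) := by
    have hm : Measurable fun z => coverIndicator o c η β (z, N.totalPower ω) :=
      (measurable_coverIndicator η β).comp (measurable_id.prodMk measurable_const)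
    rw [lintegral_intensity hm, Fintype.sum_sum_type]
    simp only [coverIndicator_inl_mk, coverIndicator_inr_mk, Sum.elim_inl, lintegral_zero,
      mul_zero, Finset.sum_const_zero, add_zero]
    refine Finset.sum_congr rfl fun k _ => ?_
    have hb : 0 < β k := by linarith [hβ k]
    have he := (o k).exponent_pos
    rw [(o k).lintegral_lt_rxPower, ENNReal.mul_inv (.inl (by simpa)) (.inl (by simp)),
      ENNReal.mul_rpow_of_nonneg _ _ (by positivity), ← mul_assoc,
      ← ENNReal.ofReal_inv_of_pos hb, ENNReal.ofReal_rpow_of_pos (by positivity),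
      ← ENNReal.ofReal_mul (mul_nonneg Real.pi_pos.le (o k).effDensity_nonneg),
      Real.inv_rpow hb.le, Real.rpow_neg hb.le]
  have h2 (ω : Ω) : ∑' p, markPower o c (N.point p ω) = N.totalPower ω := rfl
  simp_rw [h2, h1]
  rw [lintegral_finsetSum _ fun k _ => by fun_prop]
  refine Finset.sum_congr rfl fun k _ => ?_
  have hb : 0 < β k := by linarith [hβ k]
  have he := (o k).exponent_pos
  have ha := (o k).effDensity_nonneg
  have hG : 0 < Real.Gamma (1 + 2 / (o k).exponent) := Real.Gamma_pos_of_pos (by positivity)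
  rw [lintegral_const_mul _ (by fun_prop), ← N.lintegral_totalPower_rpow hη he, ← mul_assoc,
    ← ENNReal.ofReal_mul (by positivity)]
  congr 2
  field_simp

end Network

/-! ### The single path-loss exponent and the final statement -/

open Network

/-- The radial integral in the interference-limited network with a single path-loss exponent. -/
lemma integral_radialIntegrand_eq {K L : ℕ} (o : Fin K → Tier) (c : Fin L → Tier) {e : ℝ}
    (he : 2 < e) (ho : ∀ k, (o k).exponent = e) (hc : ∀ l, (c l).exponent = e)
    (hpos : 0 < (∑ l, (c l).effDensity) + ∑ l, (o l).effDensity) :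
    ∫ r in Set.Ioi (0 : ℝ), radialIntegrand o c 0 e r =
      Real.Gamma (1 + 2 / e) * Real.sinc (2 * Real.pi / e) /
        ((∑ l, (c l).effDensity) + ∑ l, (o l).effDensity) := by
  have he0 : 0 < e := by linarith
  have hd : 0 < 2 / e := by positivity
  have hd1 : 2 / e < 1 := (div_lt_one he0).2 he
  set A := (∑ l, (c l).effDensity) + ∑ l, (o l).effDensity with hA
  set D := Real.Gamma (1 + 2 / e) * Real.sinc (2 * Real.pi / e) with hD
  have hDpos : 0 < D := by
    -- The reflection formula gives `Γ(1 - 2/e) = 1 / D`, so the sign of `D` needs no separate study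
    -- of the sinc.
    have h1 : 0 < Real.Gamma (1 - 2 / e) := Real.Gamma_pos_of_pos (by linarith)
    rw [gamma_one_sub_eq hd hd1, one_div, inv_pos] at h1
    rw [hD, mul_comm 2 Real.pi, mul_div_assoc]
    exact h1
  have hexp {m : ℕ} (t : Fin m → Tier) (ht : ∀ k, (t k).exponent = e) (r : ℝ) :
      interferenceExponent t e r = Real.pi / D * (∑ l, (t l).effDensity) * r ^ (2 : ℝ) := by
    rw [interferenceExponent, Finset.mul_sum, Finset.sum_mul]
    refine Finset.sum_congr rfl fun l _ => ?_
    rw [ht, mul_div_cancel_right₀ _ he0.ne']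
    ring
  -- All powers `r ^ (2 e / ε_t)` become `r ^ 2`, so the integral is Gaussian.
  have hint (r : ℝ) : radialIntegrand o c 0 e r =
      2 * Real.pi * (r ^ (1 : ℝ) * Real.exp (-(Real.pi / D * A) * r ^ (2 : ℝ))) := by
    rw [radialIntegrand, hexp c hc, hexp o ho, Real.rpow_one, mul_assoc, hA]
    congr 3
    ring
  simp_rw [hint]
  rw [integral_const_mul, integral_rpow_mul_exp_neg_mul_rpow two_pos (by norm_num) (by positivity)]
  norm_num
  rw [Real.rpow_neg_one]
  field_simp

end HetNet

end

theorem mainTheorem2 {Ω : Type*} [MeasurableSpace Ω] (μ : Measure Ω) [IsProbabilityMeasure μ]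
    {K L : ℕ} (o : Fin K → HetNet.Tier) (c : Fin L → HetNet.Tier)
    (N : HetNet.Network μ o c) (η : ℝ) (hη : 0 ≤ η)
    (hfading : ∀ k, 0 < (o k).fading (Set.Ioi 0))
    (β : Fin K → ℝ) (hβ : ∀ k, 1 ≤ β k) :
    N.coverageMaxSINR η β = N.coverageMIRP η β ∧
    (∀ k, IntegrableOn (HetNet.radialIntegrand o c η (o k).exponent) (Set.Ioi 0)) ∧
    N.coverageMaxSINR η β =
      ∑ k, (o k).effDensity * β k ^ (-(2 / (o k).exponent)) /
          Real.Gamma (1 + 2 / (o k).exponent) *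
        ∫ r in Set.Ioi (0 : ℝ), HetNet.radialIntegrand o c η (o k).exponent r ∧
    (η = 0 → ∀ ε : ℝ, (∀ k, (o k).exponent = ε) → (∀ l, (c l).exponent = ε) →
      N.coverageMaxSINR η β =
        ∑ k, (o k).effDensity * Real.sinc (2 * Real.pi / ε) * β k ^ (-(2 / ε)) /
          ((∑ l, (c l).effDensity) + (∑ l, (o l).effDensity))) := by
  have hcov := N.measure_coverage hη hβ
  have hcoef (k : Fin K) : 0 < (o k).effDensity * β k ^ (-(2 / (o k).exponent)) /
      Real.Gamma (1 + 2 / (o k).exponent) := by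
    have hb : 0 < β k := by linarith [hβ k]
    have he := (o k).exponent_pos
    have ha := (o k).effDensity_pos (hfading k)
    have hG : 0 < Real.Gamma (1 + 2 / (o k).exponent) := Real.Gamma_pos_of_pos (by positivity)
    positivity
  have hnonneg (k : Fin K) : 0 ≤ᵐ[volume.restrict (Set.Ioi (0 : ℝ))]
      HetNet.radialIntegrand o c η (o k).exponent := by
    filter_upwards [ae_restrict_mem measurableSet_Ioi] with r hr
    exact HetNet.Network.radialIntegrand_nonneg hr
  -- Convergence comes for free: the integrals, with strictly positive coefficients, add up to a
  -- probability. Positivity of the coefficients is where nonvanishing fading enters.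
  have hfin (k : Fin K) : ∫⁻ r in Set.Ioi (0 : ℝ),
      ENNReal.ofReal (HetNet.radialIntegrand o c η (o k).exponent r) ≠ ∞ := by
    have h1 := ENNReal.sum_ne_top.1 (hcov ▸ measure_ne_top μ _) k (Finset.mem_univ k)
    intro h
    rw [h, ENNReal.mul_top (by simpa using hcoef k)] at h1
    exact h1 rfl
  have hint (k : Fin K) :
      IntegrableOn (HetNet.radialIntegrand o c η (o k).exponent) (Set.Ioi 0) := by
    refine ⟨(HetNet.Network.measurable_radialIntegrand η _).aestronglyMeasurable, ?_⟩
    rw [hasFiniteIntegral_iff_ofReal (hnonneg k)]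
    exact (hfin k).lt_top
  have hmain : N.coverageMaxSINR η β =
      ∑ k, (o k).effDensity * β k ^ (-(2 / (o k).exponent)) /
          Real.Gamma (1 + 2 / (o k).exponent) *
        ∫ r in Set.Ioi (0 : ℝ), HetNet.radialIntegrand o c η (o k).exponent r := by
    rw [HetNet.Network.coverageMaxSINR, measureReal_def, hcov, ENNReal.toReal_sum]
    · refine Finset.sum_congr rfl fun k _ => ?_
      rw [ENNReal.toReal_mul, ENNReal.toReal_ofReal (hcoef k).le,
        integral_eq_lintegral_of_nonneg_ae (hnonneg k)
          (HetNet.Network.measurable_radialIntegrand η _).aestronglyMeasurable]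
    · exact fun k _ => ENNReal.mul_ne_top (by simp) (hfin k)
  refine ⟨N.coverageMaxSINR_eq_coverageMIRP η hβ, hint, hmain, fun h0 ε ho hc => ?_⟩
  rw [hmain]
  refine Finset.sum_congr rfl fun k _ => ?_
  have he : 2 < ε := ho k ▸ (o k).two_lt_exponent
  have hG : 0 < Real.Gamma (1 + 2 / ε) := Real.Gamma_pos_of_pos (by positivity)
  have hpos : 0 < (∑ l, (c l).effDensity) + ∑ l, (o l).effDensity :=
    add_pos_of_nonneg_of_pos (Finset.sum_nonneg fun l _ => (c l).effDensity_nonneg)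
      (Finset.sum_pos (fun l _ => (o l).effDensity_pos (hfading l)) ⟨k, Finset.mem_univ k⟩)
  rw [ho k, h0, HetNet.integral_radialIntegrand_eq o c he ho hc hpos]
  field_simp
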